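/- Let $\mathcal X,\mathcal Y,\mathcal Z_1,\mathcal Z_2$ be finite sets and let $p(y,z_1,z_2\mid x)$ be the transition probability of a discrete memoryless channel with input $X$ and outputs $Y$ (legitimate receiver) and $Z_1,Z_2$ (two possible realizations of an eavesdropper), such that $X\to Z_1\to Z_2$ is a Markov chain for every distribution of $X$. A code of block length $n$ with message set sizes $M_{1,n},M_{2,n}\ge 1$ consists of a stochastic encoder, which assigns to each message pair a probability distribution on $\mathcal X^n$, and a decoder $\mathcal Y^n\to\{1,\dots,M_{1,n}\}\times\{1,\dots,M_{2,n}\}$. The messages $M_1$ and $M_2$ are independent and uniformly distributed on $\{1,\dots,M_{1,n}\}$ and $\{1,\dots,M_{2,n}\}$. A pair $(R_1,R_2)$ of nonnegative reals is called achievable if there is a sequence of codes, one for each block length $n$, such that, as $n\to\infty$, $\frac1n\log_2 M_{1,n}\to R_1$, $\frac1n\log_2 M_{2,n}\to R_2$, the probability that the decoder does not recover $(M_1,M_2)$ from $Y^n$ tends to $0$, and $$\frac1n I(M_1,M_2;Z_2^n)\to 0,\qquad \frac1n I(M_1;Z_1^n)\to 0 .$$ Then a nonnegative pair $(R_1,R_2)$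 is achievable if $$R_1\le I(X;Y)-I(X;Z_1),\qquad R_1+R_2\le I(X;Y)-I(X;Z_2)$$ for some input distribution $p(x)$. More generally, a nonnegative pair $(R_1,R_2)$ is achievable if $$R_1\le I(V;Y\mid U)-I(V;Z_1\mid U),\qquad R_1+R_2\le I(V;Y)-I(V;Z_2)$$ for some joint distribution $p(u,v,x)$, where $U$ and $V$ are auxiliary random variables with values in finite sets such that $U\to V\to X\to(Y,Z_1,Z_2)$ is a Markov chain and $I(U;Y)\ge I(U;Z_2)$. All mutual informations are in bits. -/

import Mathlib

open Filter Topology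

namespace TwoLevelWiretap

noncomputable section

/-- Shannon entropy, in bits, of a probability mass function on a finite alphabet. -/
def entropy {α : Type*} [Fintype α] (p : PMF α) : ℝ :=
  (∑ a, Real.negMulLog (p a).toReal) / Real.log 2

/-- `I(A;B) = H(A) + H(B) - H(A,B)`, in bits, for random variables `A`, `B` on `(Ω, p)`. -/
def mutualInfo {Ω α β : Type*} [Fintype α] [Fintype β]
    (p : PMF Ω) (A : Ω → α) (B : Ω → β) : ℝ :=
  entropy (p.map A) + entropy (p.map B) - entropy (p.map fun ω => (A ω, B ω))

/-- `I(A;B|C) = H(A,C) + H(B,C) - H(A,B,C) - H(C)`, in bits. -/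
def condMutualInfo {Ω α β γ : Type*} [Fintype α] [Fintype β] [Fintype γ]
    (p : PMF Ω) (A : Ω → α) (B : Ω → β) (C : Ω → γ) : ℝ :=
  entropy (p.map fun ω => (A ω, C ω)) + entropy (p.map fun ω => (B ω, C ω))
    - entropy (p.map fun ω => (A ω, B ω, C ω)) - entropy (p.map C)

/-- `A → B → C` is a Markov chain under `p`: `p(a,b,c) p(b) = p(a,b) p(b,c)`. -/
def IsMarkovChain {Ω α β γ : Type*} (p : PMF Ω) (A : Ω → α) (B : Ω → β) (C : Ω → γ) : Prop :=
  ∀ a b c, (p.map fun ω => (A ω, B ω, C ω)) (a, b, c) * (p.map B) b =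
    (p.map fun ω => (A ω, B ω)) (a, b) * (p.map fun ω => (B ω, C ω)) (b, c)

/-- Transition probability `p(y, z₁, z₂ | x)` of a broadcast channel with three receivers. -/
abbrev Channel (𝒳 𝒴 𝒵₁ 𝒵₂ : Type*) := 𝒳 → PMF (𝒴 × 𝒵₁ × 𝒵₂)

/-- The law of `(A, O)` where `A` has law `p` and, given `A = a`, the variable `O` has law
`W (X a)`. -/
def jointLaw {α 𝒳 𝒪 : Type*} (p : PMF α) (X : α → 𝒳) (W : 𝒳 → PMF 𝒪) : PMF (α × 𝒪) :=
  p.bind fun a => (W (X a)).map fun o => (a, o)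

/-- `X → Z₁ → Z₂` is a Markov chain for every input distribution. -/
def Channel.IsDegraded {𝒳 𝒴 𝒵₁ 𝒵₂ : Type*} (W : Channel 𝒳 𝒴 𝒵₁ 𝒵₂) : Prop :=
  ∀ p : PMF 𝒳, IsMarkovChain (jointLaw p id W)
    (fun ω => ω.1) (fun ω => ω.2.2.1) (fun ω => ω.2.2.2)

/-- The product law of independent variables with laws `P i`. -/
def piPMF {n : ℕ} {𝒪 : Type*} [Fintype 𝒪] (P : Fin n → PMF 𝒪) : PMF (Fin n → 𝒪) :=
  PMF.ofFintype (fun o => ∏ i, P i (o i)) (by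
    classical
    have h : ∀ i, ∑ a, P i a = 1 := fun i => by
      rw [← tsum_fintype (L := .unconditional _)]; exact (P i).tsum_coe
    have := (Finset.prod_univ_sum (fun _ : Fin n => (Finset.univ : Finset 𝒪))
      (fun i a => P i a)).symm
    rw [Fintype.piFinset_univ] at this
    rw [this]
    simp [h])

/-- A code of block length `n` with `M₁` high-security and `M₂` low-security messages: a stochastic
encoder and a decoder for the legitimate receiver. -/
structure Code (𝒳 𝒴 : Type*) (M₁ M₂ : ℕ+) (n : ℕ) where
  enc : Fin M₁ × Fin M₂ → PMF (Fin n → 𝒳)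
  dec : (Fin n → 𝒴) → Fin M₁ × Fin M₂

section Code

variable {𝒳 𝒴 𝒵₁ 𝒵₂ : Type*} [Fintype 𝒴] [Fintype 𝒵₁] [Fintype 𝒵₂] {M₁ M₂ : ℕ+} {n : ℕ}

/-- The joint law of the messages `(M₁, M₂)`, independent and uniform, and of the `n` channel
outputs `(Y[i], Z₁[i], Z₂[i])` when the code is used over the memoryless channel `W`. -/
def Code.law (c : Code 𝒳 𝒴 M₁ M₂ n) (W : Channel 𝒳 𝒴 𝒵₁ 𝒵₂) :
    PMF ((Fin M₁ × Fin M₂) × (Fin n → 𝒴 × 𝒵₁ × 𝒵₂)) :=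
  jointLaw (PMF.uniformOfFintype (Fin M₁ × Fin M₂)) id
    fun m => (c.enc m).bind fun x => piPMF fun i => W (x i)

/-- Probability that the legitimate receiver does not recover both messages. -/
def Code.errorProb (c : Code 𝒳 𝒴 M₁ M₂ n) (W : Channel 𝒳 𝒴 𝒵₁ 𝒵₂) : ℝ :=
  ((c.law W).toOuterMeasure {ω | c.dec (fun i => (ω.2 i).1) ≠ ω.1}).toReal

/-- `I(M₁; Z₁ⁿ)`. -/
def Code.leakStrong (c : Code 𝒳 𝒴 M₁ M₂ n) (W : Channel 𝒳 𝒴 𝒵₁ 𝒵₂) : ℝ :=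
  mutualInfo (c.law W) (fun ω => ω.1.1) (fun ω i => (ω.2 i).2.1)

/-- `I(M₁, M₂; Z₂ⁿ)`. -/
def Code.leakWeak (c : Code 𝒳 𝒴 M₁ M₂ n) (W : Channel 𝒳 𝒴 𝒵₁ 𝒵₂) : ℝ :=
  mutualInfo (c.law W) (fun ω => ω.1) (fun ω i => (ω.2 i).2.2)

/-- `(R₁, R₂)` is achievable: there is a sequence of codes, one for each block length `n`, of
asymptotic rates `R₁` and `R₂`, with vanishing error probability, `I(M₁, M₂; Z₂ⁿ) / n → 0` and
`I(M₁; Z₁ⁿ) / n → 0`. -/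
def Channel.IsAchievable (W : Channel 𝒳 𝒴 𝒵₁ 𝒵₂) (R₁ R₂ : ℝ) : Prop :=
  ∃ (M₁ M₂ : ℕ → ℕ+) (c : ∀ n, Code 𝒳 𝒴 (M₁ n) (M₂ n) n),
    Tendsto (fun n : ℕ => Real.logb 2 (M₁ n : ℕ) / n) atTop (𝓝 R₁) ∧
    Tendsto (fun n : ℕ => Real.logb 2 (M₂ n : ℕ) / n) atTop (𝓝 R₂) ∧
    Tendsto (fun n : ℕ => (c n).errorProb W) atTop (𝓝 0) ∧
    Tendsto (fun n : ℕ => (c n).leakWeak W / n) atTop (𝓝 0) ∧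
    Tendsto (fun n : ℕ => (c n).leakStrong W / n) atTop (𝓝 0)

end Code

end

end TwoLevelWiretap

open TwoLevelWiretap

/-! The proof is superposition random coding. Cloud centres are drawn i.i.d. from p(u), satellites
conditionally i.i.d. from p(v|u), and the selected satellite is sent through p(x|v). M₂ is split
into a part of rate a₂ indexing clouds and a part of rate b₂ indexing satellites; M₁ indexes
satellites only. Both layers also carry uniform dummy indices, of rates ra and rb.

Taking a₂ + ra = I(U;Y) and r₁ + b₂ + rb = I(V;Y|U), up to a small back-off, makes the codeword
decodable. If ra ≥ I(U;Z₂) and ra + rb ≥ I(V;Z₂), the dummy indices alone make the law of Z₂ⁿ nearly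
the same for every message pair. If b₂ + rb ≥ I(V;Z₁|U), the law of Z₁ⁿ hardly depends on M₁: here
b₂ protects M₁ as a dummy index does, and the reference law may use the cloud centres because they
carry nothing of M₁. The hypotheses are what is needed to solve these constraints with nonnegative
rates (`isAchievable_of_kernels`).

No typical sets are used. Error and leakages are means, over the codebook, of functions of a sum of
likelihoods over a sub-codebook. Jensen's inequality (concavity of the logarithm, convexity of the
reciprocal) replaces this sum by its mean given one codeword (`condMean`, `sum_bookWeight_mul_le`).
What remains are information densities, sums of n i.i.d. terms whose mean absolute deviation is
O(√n) (`exists_deviation_bound`). This gives `exists_weak_bound`, `exists_strong_bound` and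
`exists_error_bound`; `exists_code_le_mean` finds one codebook good for all three, and a back-off
n^(-1/4) makes everything vanish (`exists_codes_of_rates`). The version without auxiliary variables
is the case U constant, V = X. -/

namespace TwoLevelWiretap

/-! ### Moments under product laws -/

section FiniteSums

variable {ι X : Type*} [Fintype ι] [DecidableEq ι] [Fintype X]

theorem sum_pi_prod {R : Type*} [CommSemiring R] (f : ι → X → R) :
    ∑ c : ι → X, ∏ i, f i (c i) = ∏ i, ∑ x, f i x := by
  have := Finset.prod_univ_sum (fun _ : ι => (Finset.univ : Finset X)) f
  rw [Fintype.piFinset_univ] at this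
  exact this.symm

theorem sum_pi_prod_mul (q : ι → X → ℝ) (hq : ∀ i, ∑ x, q i x = 1) (i : ι) (F : X → ℝ) :
    ∑ c : ι → X, (∏ k, q k (c k)) * F (c i) = ∑ x, q i x * F x := by
  have h : ∀ c : ι → X, (∏ k, q k (c k)) * F (c i) =
      ∏ k, (q k (c k) * if k = i then F (c k) else 1) := fun c => by
    rw [Finset.prod_mul_distrib, Finset.prod_ite_eq' Finset.univ i fun k => F (c k)]
    simp
  simp_rw [h]
  rw [sum_pi_prod fun k x => q k x * if k = i then F x else 1,
    ← Finset.mul_prod_erase _ _ (Finset.mem_univ i), Finset.prod_eq_one, mul_one]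
  · simp
  · intro k hk
    simp [(Finset.mem_erase.1 hk).1, hq]

theorem sum_pi_prod_mul_mul (q : ι → X → ℝ) (hq : ∀ i, ∑ x, q i x = 1) {i j : ι} (hij : i ≠ j)
    (F G : X → ℝ) :
    ∑ c : ι → X, (∏ k, q k (c k)) * (F (c i) * G (c j)) =
      (∑ x, q i x * F x) * ∑ x, q j x * G x := by
  have h : ∀ c : ι → X, (∏ k, q k (c k)) * (F (c i) * G (c j)) =
      ∏ k, (q k (c k) * ((if k = i then F (c k) else 1) * if k = j then G (c k) else 1)) :=
    fun c => by
      rw [Finset.prod_mul_distrib, Finset.prod_mul_distrib,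
        Finset.prod_ite_eq' Finset.univ i fun k => F (c k),
        Finset.prod_ite_eq' Finset.univ j fun k => G (c k)]
      simp
  simp_rw [h]
  rw [sum_pi_prod fun k x => q k x * ((if k = i then F x else 1) * if k = j then G x else 1),
    ← Finset.mul_prod_erase _ _ (Finset.mem_univ i),
    ← Finset.mul_prod_erase _ _ (Finset.mem_erase.2 ⟨hij.symm, Finset.mem_univ j⟩),
    Finset.prod_eq_one, mul_one]
  · simp [hij, hij.symm]
  · intro k hk
    have h1 := Finset.mem_erase.1 hk
    simp [h1.1, (Finset.mem_erase.1 h1.2).1, hq]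

theorem sum_pi_prod_eq_one (q : ι → X → ℝ) (hq : ∀ i, ∑ x, q i x = 1) :
    ∑ c : ι → X, ∏ k, q k (c k) = 1 := by
  rw [sum_pi_prod]; simp [hq]

/-- The variance of a sum of independent identically distributed centred variables. -/
theorem sum_pi_prod_mul_sq (n : ℕ) (q : X → ℝ) (hq : ∑ x, q x = 1) (ξ : X → ℝ)
    (hξ : ∑ x, q x * ξ x = 0) :
    ∑ c : Fin n → X, (∏ k, q (c k)) * (∑ i, ξ (c i)) ^ 2 = n * ∑ x, q x * ξ x ^ 2 := by
  have h : ∀ i j : Fin n, ∑ c : Fin n → X, (∏ k, q (c k)) * (ξ (c i) * ξ (c j)) =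
      if i = j then ∑ x, q x * ξ x ^ 2 else 0 := fun i j => by
    split_ifs with hij
    · subst hij
      rw [sum_pi_prod_mul (fun _ => q) (fun _ => hq) i fun x => ξ x * ξ x]
      simp [sq]
    · rw [sum_pi_prod_mul_mul (fun _ => q) (fun _ => hq) hij, hξ, zero_mul]
  simp_rw [sq (∑ i, ξ _), Finset.sum_mul_sum, Finset.mul_sum]
  rw [Finset.sum_comm]
  simp_rw [Finset.sum_comm (s := (Finset.univ : Finset (Fin n → X))), h]
  simp [Finset.mul_sum]

/-- Pointwise |s| ≤ √n + s²/√n, and the variance of the sum is linear in n, so both terms have mean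
of order √n. -/
theorem sum_pi_prod_mul_abs_le (n : ℕ) (q : X → ℝ) (hq0 : ∀ x, 0 ≤ q x) (hq : ∑ x, q x = 1)
    (ξ : X → ℝ) (hξ : ∑ x, q x * ξ x = 0) :
    ∑ c : Fin n → X, (∏ k, q (c k)) * |∑ i, ξ (c i)| ≤ (1 + ∑ x, q x * ξ x ^ 2) * √n := by
  rcases Nat.eq_zero_or_pos n with rfl | hn
  · simp
  have hs : 0 < √(n : ℝ) := Real.sqrt_pos.2 (by exact_mod_cast hn)
  have hss : √(n : ℝ) * √n = n := Real.mul_self_sqrt (by positivity)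
  have key : ∀ c : Fin n → X, (∏ k, q (c k)) * |∑ i, ξ (c i)| ≤
      (∏ k, q (c k)) * √n + (∏ k, q (c k)) * (∑ i, ξ (c i)) ^ 2 / √n := fun c => by
    rw [mul_div_assoc, ← mul_add]
    refine mul_le_mul_of_nonneg_left ?_ (Finset.prod_nonneg fun _ _ => hq0 _)
    rw [← sub_nonneg]
    have : √(n : ℝ) + (∑ i, ξ (c i)) ^ 2 / √n - |∑ i, ξ (c i)| =
        (√n * √n + |∑ i, ξ (c i)| ^ 2 - √n * |∑ i, ξ (c i)|) / √n := by
      rw [sq_abs]; field_simp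
    rw [this]
    apply div_nonneg _ hs.le
    nlinarith [sq_nonneg (√(n : ℝ) - |∑ i, ξ (c i)|), abs_nonneg (∑ i, ξ (c i)), hs.le,
      mul_nonneg hs.le (abs_nonneg (∑ i, ξ (c i)))]
  refine (Finset.sum_le_sum fun c _ => key c).trans (le_of_eq ?_)
  rw [Finset.sum_add_distrib, ← Finset.sum_mul, ← Finset.sum_div, sum_pi_prod_mul_sq n q hq ξ hξ,
    sum_pi_prod_eq_one (fun _ => q) fun _ => hq]
  rw [one_mul, add_mul, one_mul, mul_div_right_comm, Real.div_sqrt, mul_comm]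

end FiniteSums

/-! ### Deviation of i.i.d. sums along a chain U → V → Z -/

section Deviation

variable {U V Z : Type*} [Fintype U] [Fintype V] [Fintype Z]

/-- Mean absolute deviation of a sum of `n` independent copies of `ξ (u, v, z)`. -/
theorem exists_deviation_bound (p : U → ℝ) (q : U → V → ℝ) (w : V → Z → ℝ)
    (hp : p ∈ stdSimplex ℝ U) (hq : ∀ u, q u ∈ stdSimplex ℝ V) (hw : ∀ v, w v ∈ stdSimplex ℝ Z)
    (ξ : U → V → Z → ℝ) (μ : ℝ) (hμ : ∑ u, ∑ v, ∑ z, p u * q u v * w v z * ξ u v z = μ) :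
    ∃ K : ℝ, 0 ≤ K ∧ ∀ n : ℕ, ∑ u : Fin n → U, ∑ v : Fin n → V, ∑ z : Fin n → Z,
      (∏ i, p (u i)) * (∏ i, q (u i) (v i)) * (∏ i, w (v i) (z i)) *
        |∑ i, ξ (u i) (v i) (z i) - n * μ| ≤ K * √n := by
  set r : U × V × Z → ℝ := fun t => p t.1 * q t.1 t.2.1 * w t.2.1 t.2.2 with hr
  have hr0 : ∀ t, 0 ≤ r t := fun t =>
    mul_nonneg (mul_nonneg (hp.1 _) ((hq _).1 _)) ((hw _).1 _)
  have hr1 : ∑ t, r t = 1 := by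
    simp_rw [hr, Fintype.sum_prod_type, ← Finset.mul_sum, (hw _).2, mul_one, ← Finset.mul_sum,
      (hq _).2, mul_one, hp.2]
  have hc : ∑ t, r t * (ξ t.1 t.2.1 t.2.2 - μ) = 0 := by
    simp_rw [mul_sub, Finset.sum_sub_distrib, ← Finset.sum_mul, hr1]
    simp_rw [hr, Fintype.sum_prod_type, hμ]
    ring
  refine ⟨1 + ∑ t, r t * (ξ t.1 t.2.1 t.2.2 - μ) ^ 2, ?_, fun n => ?_⟩
  · have := Finset.sum_nonneg fun t (_ : t ∈ Finset.univ) =>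
      mul_nonneg (hr0 t) (sq_nonneg (ξ t.1 t.2.1 t.2.2 - μ))
    linarith
  · refine le_of_eq_of_le ?_ (sum_pi_prod_mul_abs_le n r hr0 hr1 _ hc)
    simp_rw [← Fintype.sum_prod_type']
    -- A triple of words is the same as a word of triples, whose letters are independent of law r.
    let e : (Fin n → U) × (Fin n → V) × (Fin n → Z) ≃ (Fin n → U × V × Z) :=
      { toFun := fun t i => (t.1 i, t.2.1 i, t.2.2 i)
        invFun := fun c => (fun i => (c i).1, fun i => (c i).2.1, fun i => (c i).2.2)
        left_inv := fun _ => rfl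
        right_inv := fun _ => rfl }
    refine Fintype.sum_equiv e _ _ fun t => ?_
    simp [e, hr, Finset.prod_mul_distrib]

end Deviation

/-! ### The random superposition codebook and Jensen's inequality -/

section Codebook

variable {U V A B : Type*} [Fintype U] [Fintype V] [Fintype A] [Fintype B]

/-- Probability of a superposition codebook: `A` independent cloud centres of law `p`, each with
`B` satellites which are conditionally independent of law `q` given the centre. -/
noncomputable def bookWeight (p : U → ℝ) (q : U → V → ℝ) (C : A → U × (B → V)) : ℝ :=
  ∏ a, (p (C a).1 * ∏ b, q (C a).1 ((C a).2 b))

variable {p : U → ℝ} {q : U → V → ℝ}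

theorem bookWeight_nonneg (hp : p ∈ stdSimplex ℝ U) (hq : ∀ u, q u ∈ stdSimplex ℝ V)
    (C : A → U × (B → V)) : 0 ≤ bookWeight p q C :=
  Finset.prod_nonneg fun _ _ => mul_nonneg (hp.1 _) (Finset.prod_nonneg fun _ _ => (hq _).1 _)

theorem pos_of_bookWeight_ne_zero (hp : p ∈ stdSimplex ℝ U) (hq : ∀ u, q u ∈ stdSimplex ℝ V)
    {C : A → U × (B → V)} (hC : bookWeight p q C ≠ 0) (a : A) (b : B) :
    0 < p (C a).1 ∧ 0 < q (C a).1 ((C a).2 b) := by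
  have h := Finset.prod_ne_zero_iff.1 hC a (Finset.mem_univ a)
  exact ⟨(hp.1 _).lt_of_ne' (left_ne_zero_of_mul h), ((hq _).1 _).lt_of_ne'
    (Finset.prod_ne_zero_iff.1 (right_ne_zero_of_mul h) b (Finset.mem_univ b))⟩

/-- Conditional mean, given the codeword with centre `u` and satellite `v`, of the sum of `k` over
a sub-codebook of `J` clouds with `K` satellites each that contains this codeword. -/
noncomputable def condMean (p : U → ℝ) (q : U → V → ℝ) (J K : ℕ) (k : V → ℝ) (u : U) (v : V) : ℝ :=
  k v + (K - 1) * (∑ v', q u v' * k v') + (J - 1) * K * ∑ u', p u' * ∑ v', q u' v' * k v'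

theorem condMean_pos (hp : p ∈ stdSimplex ℝ U) (hq : ∀ u, q u ∈ stdSimplex ℝ V)
    {J K : ℕ} (hJ : 1 ≤ J) (hK : 1 ≤ K) {k : V → ℝ} (hk : ∀ v, 0 ≤ k v) (u : U) {v : V}
    (hv : 0 < k v) : 0 < condMean p q J K k u v := by
  have h1 : (1 : ℝ) ≤ J := by exact_mod_cast hJ
  have h2 : (1 : ℝ) ≤ K := by exact_mod_cast hK
  have h3 : ∀ u, 0 ≤ ∑ v', q u v' * k v' := fun u =>
    Finset.sum_nonneg fun v _ => mul_nonneg ((hq u).1 v) (hk v)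
  have h4 : 0 ≤ ∑ u', p u' * ∑ v', q u' v' * k v' :=
    Finset.sum_nonneg fun u _ => mul_nonneg (hp.1 u) (h3 u)
  have h5 := mul_nonneg (sub_nonneg.2 h2) (h3 u)
  have h6 := mul_nonneg (mul_nonneg (sub_nonneg.2 h1) (zero_le_one.trans h2)) h4
  unfold condMean
  linarith

variable [DecidableEq B]

theorem sum_cloudWeight (hp : p ∈ stdSimplex ℝ U) (hq : ∀ u, q u ∈ stdSimplex ℝ V) :
    ∑ c : U × (B → V), p c.1 * ∏ b, q c.1 (c.2 b) = 1 := by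
  simp_rw [Fintype.sum_prod_type, ← Finset.mul_sum]
  simp_rw [sum_pi_prod_eq_one (fun _ => q _) fun _ => (hq _).2, mul_one, hp.2]

variable [DecidableEq A]

theorem sum_bookWeight (hp : p ∈ stdSimplex ℝ U) (hq : ∀ u, q u ∈ stdSimplex ℝ V) :
    ∑ C : A → U × (B → V), bookWeight p q C = 1 :=
  sum_pi_prod_eq_one (fun _ (c : U × (B → V)) => p c.1 * ∏ b, q c.1 (c.2 b))
    fun _ => sum_cloudWeight hp hq

theorem sum_bookWeight_mul (hp : p ∈ stdSimplex ℝ U) (hq : ∀ u, q u ∈ stdSimplex ℝ V)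
    (a : A) (b : B) (h : U → V → ℝ) :
    ∑ C : A → U × (B → V), bookWeight p q C * h (C a).1 ((C a).2 b) =
      ∑ u, ∑ v, p u * q u v * h u v := by
  refine (sum_pi_prod_mul (fun _ (c : U × (B → V)) => p c.1 * ∏ b, q c.1 (c.2 b))
    (fun _ => sum_cloudWeight hp hq) a fun c : U × (B → V) => h c.1 (c.2 b)).trans ?_
  simp_rw [Fintype.sum_prod_type, mul_assoc, ← Finset.mul_sum]
  refine Finset.sum_congr rfl fun u _ => ?_
  rw [sum_pi_prod_mul (fun _ => q u) (fun _ => (hq _).2) b (h u)]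

/-- Satellites of one cloud are independent only given the centre, so the second factor is averaged
with u fixed. For different clouds there is full independence and u is averaged as well. -/
theorem sum_bookWeight_mul_same_cloud (hp : p ∈ stdSimplex ℝ U) (hq : ∀ u, q u ∈ stdSimplex ℝ V)
    (a : A) {b b' : B} (hb : b ≠ b') (h : U → V → ℝ) (k : V → ℝ) :
    ∑ C : A → U × (B → V), bookWeight p q C * (h (C a).1 ((C a).2 b) * k ((C a).2 b')) =
      ∑ u, ∑ v, p u * q u v * (h u v * ∑ v', q u v' * k v') := by
  refine (sum_pi_prod_mul (fun _ (c : U × (B → V)) => p c.1 * ∏ b, q c.1 (c.2 b))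
    (fun _ => sum_cloudWeight hp hq) a fun c : U × (B → V) => h c.1 (c.2 b) * k (c.2 b')).trans ?_
  simp_rw [Fintype.sum_prod_type, mul_assoc, ← Finset.mul_sum]
  refine Finset.sum_congr rfl fun u _ => ?_
  rw [sum_pi_prod_mul_mul (fun _ => q u) (fun _ => (hq _).2) hb (h u) k]
  simp_rw [← mul_assoc (q u _), ← Finset.sum_mul]

theorem sum_bookWeight_mul_other_cloud (hp : p ∈ stdSimplex ℝ U) (hq : ∀ u, q u ∈ stdSimplex ℝ V)
    {a a' : A} (ha : a ≠ a') (b b' : B) (h : U → V → ℝ) (k : V → ℝ) :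
    ∑ C : A → U × (B → V), bookWeight p q C * (h (C a).1 ((C a).2 b) * k ((C a').2 b')) =
      ∑ u, ∑ v, p u * q u v * (h u v * ∑ u', p u' * ∑ v', q u' v' * k v') := by
  refine (sum_pi_prod_mul_mul (fun _ (c : U × (B → V)) => p c.1 * ∏ b, q c.1 (c.2 b))
    (fun _ => sum_cloudWeight hp hq) ha (fun c : U × (B → V) => h c.1 (c.2 b))
    fun c : U × (B → V) => k (c.2 b')).trans ?_
  simp_rw [Fintype.sum_prod_type, mul_assoc, ← Finset.mul_sum]
  simp_rw [sum_pi_prod_mul (fun _ => q _) (fun _ => (hq _).2) b' k,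
    sum_pi_prod_mul (fun _ => q _) (fun _ => (hq _).2) b (h _), ← mul_assoc (q _ _),
    ← Finset.sum_mul, ← mul_assoc (p _), ← Finset.sum_mul]

/-- The sub-codebook splits into the codeword itself, the other satellites of its cloud, and the
satellites of the other clouds; these three groups give the three terms of `condMean`. -/
theorem sum_bookWeight_mul_sum
    (hp : p ∈ stdSimplex ℝ U) (hq : ∀ u, q u ∈ stdSimplex ℝ V)
    {A' : Finset A} {B' : Finset B} {a : A} {b : B} (ha : a ∈ A') (hb : b ∈ B')
    (h : U → V → ℝ) (k : V → ℝ) :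
    ∑ C : A → U × (B → V), bookWeight p q C *
        (h (C a).1 ((C a).2 b) * ∑ a' ∈ A', ∑ b' ∈ B', k ((C a').2 b')) =
      ∑ u, ∑ v, p u * q u v * (h u v * condMean p q A'.card B'.card k u v) := by
  have hA : ((A'.erase a).card : ℝ) = A'.card - 1 := by
    rw [Finset.card_erase_of_mem ha, Nat.cast_pred (Finset.card_pos.2 ⟨a, ha⟩)]
  have hB : ((B'.erase b).card : ℝ) = B'.card - 1 := by
    rw [Finset.card_erase_of_mem hb, Nat.cast_pred (Finset.card_pos.2 ⟨b, hb⟩)]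
  have h1 : ∀ C : A → U × (B → V), bookWeight p q C *
        (h (C a).1 ((C a).2 b) * ∑ a' ∈ A', ∑ b' ∈ B', k ((C a').2 b')) =
      bookWeight p q C * (h (C a).1 ((C a).2 b) * k ((C a).2 b)) +
      ∑ b' ∈ B'.erase b, bookWeight p q C * (h (C a).1 ((C a).2 b) * k ((C a).2 b')) +
      ∑ a' ∈ A'.erase a, ∑ b' ∈ B',
        bookWeight p q C * (h (C a).1 ((C a).2 b) * k ((C a').2 b')) := fun C => by
    rw [← Finset.add_sum_erase _ _ ha, ← Finset.add_sum_erase _ _ hb]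
    simp_rw [← Finset.mul_sum]
    ring
  simp_rw [h1, Finset.sum_add_distrib]
  rw [sum_bookWeight_mul hp hq a b fun u v => h u v * k v,
    Finset.sum_comm (t := B'.erase b), Finset.sum_comm (t := A'.erase a),
    Finset.sum_congr rfl fun b' hb' => sum_bookWeight_mul_same_cloud hp hq a
      (Finset.ne_of_mem_erase hb').symm h k,
    Finset.sum_congr rfl fun a' ha' => Finset.sum_comm.trans (Finset.sum_congr rfl fun b' _ =>
      sum_bookWeight_mul_other_cloud hp hq (Finset.ne_of_mem_erase ha').symm b b' h k)]
  simp_rw [Finset.sum_const, nsmul_eq_mul, hA, hB, Finset.mul_sum (s := (Finset.univ : Finset U)),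
    Finset.mul_sum (s := (Finset.univ : Finset V)), ← Finset.sum_add_distrib, condMean]
  refine Finset.sum_congr rfl fun u _ => Finset.sum_congr rfl fun v _ => ?_
  simp_rw [← Finset.mul_sum]
  ring

/-- Jensen's inequality for the random codebook, for a function with the supporting slope `g` at
the conditional mean. -/
theorem sum_bookWeight_mul_le
    (hp : p ∈ stdSimplex ℝ U) (hq : ∀ u, q u ∈ stdSimplex ℝ V)
    {A' : Finset A} {B' : Finset B} {a : A} {b : B} (ha : a ∈ A') (hb : b ∈ B')
    (k : V → ℝ) (hk : ∀ v, 0 ≤ k v) (f : U → V → ℝ → ℝ) (g : U → V → ℝ)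
    (hfg : ∀ u v x, 0 < p u → 0 < q u v → 0 < k v → 0 < x →
      f u v x ≤ f u v (condMean p q A'.card B'.card k u v) +
        g u v * (x - condMean p q A'.card B'.card k u v)) :
    ∑ C : A → U × (B → V), bookWeight p q C * (k ((C a).2 b) *
        f (C a).1 ((C a).2 b) (∑ a' ∈ A', ∑ b' ∈ B', k ((C a').2 b'))) ≤
      ∑ u, ∑ v, p u * q u v * (k v * f u v (condMean p q A'.card B'.card k u v)) := by
  set x₀ := condMean p q A'.card B'.card k with hx₀
  -- The supporting line is affine in the sum, so its mean is computable from first and second order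
  -- independence. After averaging, the slope term cancels because the sum has conditional mean x₀.
  have h1 : ∀ C : A → U × (B → V), bookWeight p q C * (k ((C a).2 b) *
        f (C a).1 ((C a).2 b) (∑ a' ∈ A', ∑ b' ∈ B', k ((C a').2 b'))) ≤
      bookWeight p q C * ((fun u v => k v * f u v (x₀ u v) - k v * g u v * x₀ u v)
          (C a).1 ((C a).2 b)) +
        bookWeight p q C * ((fun u v => k v * g u v) (C a).1 ((C a).2 b) *
          ∑ a' ∈ A', ∑ b' ∈ B', k ((C a').2 b')) := fun C => by
    rw [← mul_add]
    rcases eq_or_ne (bookWeight p q C) 0 with hC | hC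
    · simp [hC]
    refine mul_le_mul_of_nonneg_left ?_ (bookWeight_nonneg hp hq C)
    rcases (hk ((C a).2 b)).eq_or_lt with h0 | h0
    · simp [← h0]
    have hpos := pos_of_bookWeight_ne_zero hp hq hC a b
    have hX : 0 < ∑ a' ∈ A', ∑ b' ∈ B', k ((C a').2 b') :=
      h0.trans_le ((Finset.single_le_sum (f := fun b' => k ((C a).2 b')) (fun _ _ => hk _) hb).trans
        (Finset.single_le_sum (f := fun a' => ∑ b' ∈ B', k ((C a').2 b'))
          (fun _ _ => Finset.sum_nonneg fun _ _ => hk _) ha))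
    have := mul_le_mul_of_nonneg_left (hfg _ _ _ hpos.1 hpos.2 h0 hX) h0.le
    refine this.trans (le_of_eq ?_)
    ring
  refine (Finset.sum_le_sum fun C _ => h1 C).trans (le_of_eq ?_)
  rw [Finset.sum_add_distrib,
    sum_bookWeight_mul hp hq a b fun u v => k v * f u v (x₀ u v) - k v * g u v * x₀ u v,
    sum_bookWeight_mul_sum hp hq ha hb (fun u v => k v * g u v) k]
  simp_rw [← Finset.sum_add_distrib, ← hx₀]
  refine Finset.sum_congr rfl fun u _ => Finset.sum_congr rfl fun v _ => ?_
  ring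

/-- Concavity of the logarithm, with slope 1/x₀. The reference r may depend on the cloud centre: the
weak leakage uses the output law, the strong one the output law given the cloud. -/
theorem sum_bookWeight_mul_log_le
    (hp : p ∈ stdSimplex ℝ U) (hq : ∀ u, q u ∈ stdSimplex ℝ V)
    {A' : Finset A} {B' : Finset B} {a : A} {b : B} (ha : a ∈ A') (hb : b ∈ B')
    (k : V → ℝ) (hk : ∀ v, 0 ≤ k v) (r : U → ℝ)
    (hr : ∀ u v, 0 < p u → 0 < q u v → 0 < k v → 0 < r u) :
    ∑ C : A → U × (B → V), bookWeight p q C * (k ((C a).2 b) *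
        Real.log ((∑ a' ∈ A', ∑ b' ∈ B', k ((C a').2 b')) / r (C a).1)) ≤
      ∑ u, ∑ v, p u * q u v *
        (k v * Real.log (condMean p q A'.card B'.card k u v / r u)) := by
  refine sum_bookWeight_mul_le hp hq ha hb k hk (fun u _ x => Real.log (x / r u))
    (fun u v => (condMean p q A'.card B'.card k u v)⁻¹) fun u v x hu hv h0 hx => ?_
  have hx₀ := condMean_pos hp hq (Finset.card_pos.2 ⟨a, ha⟩) (Finset.card_pos.2 ⟨b, hb⟩) hk u h0
  have hr' := hr u v hu hv h0
  rw [Real.log_div hx.ne' hr'.ne', Real.log_div hx₀.ne' hr'.ne']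
  have := Real.log_le_sub_one_of_pos (div_pos hx hx₀)
  rw [Real.log_div hx.ne' hx₀.ne'] at this
  have h2 : (condMean p q A'.card B'.card k u v)⁻¹ * (x - condMean p q A'.card B'.card k u v) =
    x / condMean p q A'.card B'.card k u v - 1 := by field_simp
  linarith

/-- Convexity of the reciprocal. The ratio is the posterior probability of the sent codeword, so
this bounds from below the success of a decoder that samples from the posterior. -/
theorem le_sum_bookWeight_mul_div
    (hp : p ∈ stdSimplex ℝ U) (hq : ∀ u, q u ∈ stdSimplex ℝ V) (a : A) (b : B)
    (k : V → ℝ) (hk : ∀ v, 0 ≤ k v) :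
    ∑ u, ∑ v, p u * q u v *
        (k v * (k v / condMean p q (Fintype.card A) (Fintype.card B) k u v)) ≤
    ∑ C : A → U × (B → V), bookWeight p q C * (k ((C a).2 b) *
        (k ((C a).2 b) / ∑ a', ∑ b', k ((C a').2 b'))) := by
  have := sum_bookWeight_mul_le hp hq (Finset.mem_univ a) (Finset.mem_univ b) k hk
    (fun _ v x => -(k v / x))
    (fun u v => k v / (condMean p q (Fintype.card A) (Fintype.card B) k u v) ^ 2)
    fun u v x hu hv h0 hx => ?_
  · simp only [mul_neg, Finset.sum_neg_distrib, neg_le_neg_iff] at this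
    exact this
  · have hx₀ := condMean_pos (J := Fintype.card A) (K := Fintype.card B) hp hq
      (Fintype.card_pos_iff.2 ⟨a⟩) (Fintype.card_pos_iff.2 ⟨b⟩) hk u h0
    simp only [Finset.card_univ]
    set y := condMean p q (Fintype.card A) (Fintype.card B) k u v
    have : -(k v / y) + k v / y ^ 2 * (x - y) - -(k v / x) = k v * (x - y) ^ 2 / (x * y ^ 2) := by
      field_simp
      ring
    have h2 : 0 ≤ k v * (x - y) ^ 2 / (x * y ^ 2) := by positivity
    linarith

end Codebook

/-! ### Entropies as expectations, and divergence bounds -/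

section Entropy

variable {Ω Ω' α β γ : Type*}

theorem mutualInfo_map [Fintype α] [Fintype β] (P : PMF Ω') (f : Ω' → Ω) (A : Ω → α)
    (B : Ω → β) : mutualInfo (P.map f) A B = mutualInfo P (A ∘ f) (B ∘ f) := by
  simp [mutualInfo, PMF.map_comp, Function.comp_def]

theorem condMutualInfo_map [Fintype α] [Fintype β] [Fintype γ] (P : PMF Ω')
    (f : Ω' → Ω) (A : Ω → α) (B : Ω → β) (C : Ω → γ) :
    condMutualInfo (P.map f) A B C = condMutualInfo P (A ∘ f) (B ∘ f) (C ∘ f) := by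
  simp [condMutualInfo, PMF.map_comp, Function.comp_def]

variable [Fintype Ω]

theorem sum_toReal (P : PMF Ω) : ∑ ω, (P ω).toReal = 1 := by
  have h := P.tsum_coe
  rw [tsum_fintype] at h
  rw [← ENNReal.toReal_sum fun ω _ => P.apply_ne_top ω, h, ENNReal.toReal_one]

theorem toReal_mem_stdSimplex (P : PMF Ω) : (fun ω => (P ω).toReal) ∈ stdSimplex ℝ Ω :=
  ⟨fun _ => ENNReal.toReal_nonneg, sum_toReal P⟩

theorem toReal_map_apply [DecidableEq α] (P : PMF Ω) (A : Ω → α) (a : α) :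
    ((P.map A) a).toReal = ∑ ω, if A ω = a then (P ω).toReal else 0 := by
  classical
  rw [PMF.map_apply, tsum_fintype, ENNReal.toReal_sum]
  · refine Finset.sum_congr rfl fun ω _ => ?_
    by_cases h : A ω = a
    · simp [h]
    · simp [h, Ne.symm h]
  · intro ω _
    split_ifs
    · exact P.apply_ne_top ω
    · simp

theorem sum_map_mul [Fintype α] (P : PMF Ω) (A : Ω → α) (F : α → ℝ) :
    ∑ a, ((P.map A) a).toReal * F a = ∑ ω, (P ω).toReal * F (A ω) := by
  classical
  simp_rw [toReal_map_apply, Finset.sum_mul]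
  rw [Finset.sum_comm]
  simp

theorem le_toReal_map_apply (P : PMF Ω) (A : Ω → α) (ω : Ω) :
    (P ω).toReal ≤ ((P.map A) (A ω)).toReal := by
  classical
  rw [toReal_map_apply]
  have := Finset.single_le_sum (f := fun ω' => if A ω' = A ω then (P ω').toReal else 0)
    (fun ω' _ => by split_ifs <;> simp) (Finset.mem_univ ω)
  simpa using this

theorem entropy_map [Fintype α] (P : PMF Ω) (A : Ω → α) :
    entropy (P.map A) =
      -(∑ ω, (P ω).toReal * Real.log ((P.map A) (A ω)).toReal) / Real.log 2 := by
  unfold entropy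
  rw [← sum_map_mul P A fun a => Real.log ((P.map A) a).toReal]
  simp [Real.negMulLog]

/-- Mutual information as the mean of an information density over Ω. The junk value of the logarithm
at 0 does no harm, since it occurs only at points of weight zero. -/
theorem mutualInfo_eq [Fintype α] [Fintype β] (P : PMF Ω) (A : Ω → α) (B : Ω → β) :
    mutualInfo P A B = (∑ ω, (P ω).toReal *
      (Real.log ((P.map fun ω => (A ω, B ω)) (A ω, B ω)).toReal
        - Real.log ((P.map A) (A ω)).toReal
        - Real.log ((P.map B) (B ω)).toReal)) / Real.log 2 := by
  unfold mutualInfo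
  rw [entropy_map, entropy_map, entropy_map P fun ω => (A ω, B ω)]
  simp_rw [mul_sub, Finset.sum_sub_distrib]
  ring

theorem condMutualInfo_eq [Fintype α] [Fintype β] [Fintype γ] (P : PMF Ω) (A : Ω → α) (B : Ω → β)
    (C : Ω → γ) :
    condMutualInfo P A B C = (∑ ω, (P ω).toReal *
      (Real.log ((P.map fun ω => (A ω, B ω, C ω)) (A ω, B ω, C ω)).toReal
        + Real.log ((P.map C) (C ω)).toReal
        - Real.log ((P.map fun ω => (A ω, C ω)) (A ω, C ω)).toReal
        - Real.log ((P.map fun ω => (B ω, C ω)) (B ω, C ω)).toReal)) / Real.log 2 := by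
  unfold condMutualInfo
  rw [entropy_map P C, entropy_map P fun ω => (A ω, C ω), entropy_map P fun ω => (B ω, C ω),
    entropy_map P fun ω => (A ω, B ω, C ω)]
  simp_rw [mul_sub, mul_add, Finset.sum_sub_distrib, Finset.sum_add_distrib]
  ring

/-- Gibbs' inequality. -/
theorem sum_mul_log_div_nonneg {ι : Type*} (s : Finset ι) (f g : ι → ℝ) (hf : ∀ i ∈ s, 0 ≤ f i)
    (hg : ∀ i ∈ s, 0 ≤ g i) (hfg : ∀ i ∈ s, 0 < f i → 0 < g i) (h : ∑ i ∈ s, g i ≤ ∑ i ∈ s, f i) :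
    0 ≤ ∑ i ∈ s, f i * Real.log (f i / g i) := by
  refine (sub_nonneg.2 h).trans ?_
  rw [← Finset.sum_sub_distrib]
  refine Finset.sum_le_sum fun i hi => ?_
  rcases (hf i hi).eq_or_lt with h0 | h0
  · simp [← h0, hg i hi]
  have hg0 := hfg i hi h0
  have := mul_le_mul_of_nonneg_left (Real.log_le_sub_one_of_pos (div_pos hg0 h0)) h0.le
  rw [Real.log_div hg0.ne' h0.ne'] at this
  rw [Real.log_div h0.ne' hg0.ne']
  have h2 : f i * (g i / f i - 1) = g i - f i := by field_simp
  linarith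

theorem map_fst_apply_toReal [Fintype α] [Fintype β] (P : PMF (α × β)) (a : α) :
    ((P.map Prod.fst) a).toReal = ∑ b, (P (a, b)).toReal := by
  classical
  rw [toReal_map_apply, Fintype.sum_prod_type, Finset.sum_eq_single a]
  · simp
  · intro b _ hb; simp [hb]
  · simp

theorem map_snd_apply_toReal [Fintype α] [Fintype β] (P : PMF (α × β)) (b : β) :
    ((P.map Prod.snd) b).toReal = ∑ a, (P (a, b)).toReal := by
  classical
  rw [toReal_map_apply, Fintype.sum_prod_type_right, Finset.sum_eq_single b]
  · simp
  · intro b _ hb; simp [hb]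
  · simp

theorem mutualInfo_fst_snd_nonneg [Fintype α] [Fintype β] (P : PMF (α × β)) :
    0 ≤ mutualInfo P Prod.fst Prod.snd := by
  rw [mutualInfo_eq]
  refine div_nonneg ?_ (Real.log_nonneg one_le_two)
  have h := sum_mul_log_div_nonneg Finset.univ (fun ω => (P ω).toReal)
    (fun ω => ((P.map Prod.fst) ω.1).toReal * ((P.map Prod.snd) ω.2).toReal)
    (fun _ _ => ENNReal.toReal_nonneg)
    (fun _ _ => mul_nonneg ENNReal.toReal_nonneg ENNReal.toReal_nonneg)
    (fun ω _ hω => mul_pos (hω.trans_le (le_toReal_map_apply P Prod.fst ω))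
      (hω.trans_le (le_toReal_map_apply P Prod.snd ω)))
    (by simp only [Fintype.sum_prod_type, ← Finset.mul_sum, sum_toReal, mul_one, le_refl])
  refine h.trans (le_of_eq (Finset.sum_congr rfl fun ω _ => ?_))
  rcases eq_or_lt_of_le (ENNReal.toReal_nonneg (a := P ω)) with h0 | h0
  · simp [← h0]
  rw [Real.log_div h0.ne' (mul_pos (h0.trans_le (le_toReal_map_apply P Prod.fst ω))
      (h0.trans_le (le_toReal_map_apply P Prod.snd ω))).ne',
    Real.log_mul (h0.trans_le (le_toReal_map_apply P Prod.fst ω)).ne'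
      (h0.trans_le (le_toReal_map_apply P Prod.snd ω)).ne']
  have : P.map (fun ω => (ω.1, ω.2)) = P := P.map_id
  rw [this]
  ring

theorem mutualInfo_nonneg [Fintype α] [Fintype β] (P : PMF Ω') (A : Ω' → α)
    (B : Ω' → β) : 0 ≤ mutualInfo P A B := by
  have := mutualInfo_fst_snd_nonneg (P.map fun ω => (A ω, B ω))
  rwa [mutualInfo_map] at this

/-- If `m` is uniform and `T m` is the law of the output given `m`, then the mutual information is
at most the mean divergence of `T m` from any reference law `Q`. -/
theorem mutualInfo_le_divergence [Fintype α] [Fintype β] [Nonempty α] (P : PMF (α × β))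
    (T : α → β → ℝ) (hT : ∀ m, T m ∈ stdSimplex ℝ β)
    (hP : ∀ m z, (P (m, z)).toReal = (Fintype.card α : ℝ)⁻¹ * T m z)
    (Q : β → ℝ) (hQ : Q ∈ stdSimplex ℝ β) (hTQ : ∀ m z, 0 < T m z → 0 < Q z) :
    mutualInfo P Prod.fst Prod.snd ≤
      ((Fintype.card α : ℝ)⁻¹ * ∑ m, ∑ z, T m z * Real.log (T m z / Q z)) / Real.log 2 := by
  rw [mutualInfo_eq]
  refine div_le_div_of_nonneg_right ?_ (Real.log_nonneg one_le_two)
  have hα : (0 : ℝ) < (Fintype.card α : ℝ)⁻¹ := by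
    have : 0 < Fintype.card α := Fintype.card_pos
    positivity
  -- The mean divergence from Q exceeds the mutual information by exactly the divergence of the
  -- output law from Q, which is nonnegative.
  have h := sum_mul_log_div_nonneg Finset.univ (fun z => ((P.map Prod.snd) z).toReal) Q
    (fun _ _ => ENNReal.toReal_nonneg) (fun _ _ => hQ.1 _) (fun z _ hz => ?_)
    (by rw [sum_toReal, hQ.2])
  · rw [sum_map_mul P Prod.snd fun z => Real.log (((P.map Prod.snd) z).toReal / Q z)] at h
    rw [← sub_nonneg]
    refine h.trans (le_of_eq ?_)
    rw [Finset.mul_sum]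
    simp_rw [Finset.mul_sum]
    rw [← Fintype.sum_prod_type' (f := fun m z =>
      (Fintype.card α : ℝ)⁻¹ * (T m z * Real.log (T m z / Q z))), ← Finset.sum_sub_distrib]
    refine Finset.sum_congr rfl fun ω _ => ?_
    obtain ⟨m, z⟩ := ω
    rcases ((hT m).1 z).eq_or_lt with h0 | h0
    · simp [hP, ← h0]
    have hQ0 := hTQ m z h0
    have h1 : ((P.map Prod.fst) m).toReal = (Fintype.card α : ℝ)⁻¹ := by
      rw [map_fst_apply_toReal]
      simp_rw [hP, ← Finset.mul_sum, (hT m).2, mul_one]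
    have hPpos : 0 < (P (m, z)).toReal := by rw [hP]; positivity
    have h2 := hPpos.trans_le (le_toReal_map_apply P Prod.snd (m, z))
    have h3 : P.map (fun ω => (ω.1, ω.2)) = P := P.map_id
    simp only at h2 ⊢
    rw [h3, h1, hP, Real.log_div h2.ne' hQ0.ne', Real.log_div h0.ne' hQ0.ne',
      Real.log_mul hα.ne' h0.ne']
    ring
  · rw [map_snd_apply_toReal] at hz
    obtain ⟨m, -, hm⟩ := Finset.exists_ne_zero_of_sum_ne_zero hz.ne'
    rw [hP] at hm
    exact hTQ m z (((hT m).1 z).lt_of_ne' (right_ne_zero_of_mul hm))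

end Entropy

/-! ### Single-letter informations of a chain given by kernels -/

section Chain

variable {U V Z : Type*} [Fintype V]

/-- Probability of the output `z` given the cloud centre `u`. -/
noncomputable def cloudOut (q : U → V → ℝ) (w : V → Z → ℝ) (u : U) (z : Z) : ℝ :=
  ∑ v, q u v * w v z

variable [Fintype Z] {p : U → ℝ} {q : U → V → ℝ} {w : V → Z → ℝ}

theorem cloudOut_mem_stdSimplex (hq : ∀ u, q u ∈ stdSimplex ℝ V)
    (hw : ∀ v, w v ∈ stdSimplex ℝ Z) (u : U) : cloudOut q w u ∈ stdSimplex ℝ Z := by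
  refine ⟨fun z => Finset.sum_nonneg fun v _ => mul_nonneg ((hq u).1 v) ((hw v).1 z), ?_⟩
  unfold cloudOut
  rw [Finset.sum_comm]
  simp_rw [← Finset.mul_sum, (hw _).2, mul_one, (hq u).2]

theorem cloudOut_pos (hq : ∀ u, q u ∈ stdSimplex ℝ V) (hw : ∀ v, w v ∈ stdSimplex ℝ Z)
    {u : U} {v : V} {z : Z} (hv : 0 < q u v) (hz : 0 < w v z) : 0 < cloudOut q w u z :=
  (mul_pos hv hz).trans_le (Finset.single_le_sum (f := fun v => q u v * w v z)
    (fun v _ => mul_nonneg ((hq u).1 v) ((hw v).1 z)) (Finset.mem_univ v))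

variable [Fintype U]

/-- Probability of the output `z`. -/
noncomputable def out (p : U → ℝ) (q : U → V → ℝ) (w : V → Z → ℝ) (z : Z) : ℝ :=
  ∑ u, p u * cloudOut q w u z

/-- `I(V;Z)`, in nats, for a Markov chain `U → V → Z`. -/
noncomputable def infoV (p : U → ℝ) (q : U → V → ℝ) (w : V → Z → ℝ) : ℝ :=
  ∑ u, ∑ v, ∑ z, p u * q u v * w v z * Real.log (w v z / out p q w z)

/-- `I(U;Z)`, in nats, for a Markov chain `U → V → Z`. -/
noncomputable def infoU (p : U → ℝ) (q : U → V → ℝ) (w : V → Z → ℝ) : ℝ :=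
  ∑ u, ∑ v, ∑ z, p u * q u v * w v z * Real.log (cloudOut q w u z / out p q w z)

/-- `I(V;Z|U)`, in nats, for a Markov chain `U → V → Z`. -/
noncomputable def condInfo (p : U → ℝ) (q : U → V → ℝ) (w : V → Z → ℝ) : ℝ :=
  ∑ u, ∑ v, ∑ z, p u * q u v * w v z * Real.log (w v z / cloudOut q w u z)

/-- The output law is a cloud output law one level up: the input law is seen as a kernel from a
one-point space, followed by the kernel from U to Z. -/
theorem out_mem_stdSimplex (hp : p ∈ stdSimplex ℝ U) (hq : ∀ u, q u ∈ stdSimplex ℝ V)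
    (hw : ∀ v, w v ∈ stdSimplex ℝ Z) : out p q w ∈ stdSimplex ℝ Z :=
  cloudOut_mem_stdSimplex (q := fun _ : Unit => p) (fun _ => hp)
    (cloudOut_mem_stdSimplex hq hw) ()

theorem out_pos (hp : p ∈ stdSimplex ℝ U) (hq : ∀ u, q u ∈ stdSimplex ℝ V)
    (hw : ∀ v, w v ∈ stdSimplex ℝ Z) {u : U} {v : V} {z : Z} (hu : 0 < p u) (hv : 0 < q u v)
    (hz : 0 < w v z) : 0 < out p q w z :=
  cloudOut_pos (q := fun _ : Unit => p) (u := ()) (fun _ => hp) (cloudOut_mem_stdSimplex hq hw) hu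
    (cloudOut_pos hq hw hv hz)

/-- Two functions that agree on the support of the chain `U → V → Z` have the same mean. -/
theorem chain_sum_congr (hp : p ∈ stdSimplex ℝ U) (hq : ∀ u, q u ∈ stdSimplex ℝ V)
    (hw : ∀ v, w v ∈ stdSimplex ℝ Z) {F G : U → V → Z → ℝ}
    (h : ∀ u v z, 0 < p u → 0 < q u v → 0 < w v z → F u v z = G u v z) :
    ∑ u, ∑ v, ∑ z, p u * q u v * w v z * F u v z =
      ∑ u, ∑ v, ∑ z, p u * q u v * w v z * G u v z := by
  refine Finset.sum_congr rfl fun u _ => Finset.sum_congr rfl fun v _ =>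
    Finset.sum_congr rfl fun z _ => ?_
  rcases (hp.1 u).eq_or_lt with h0 | hu
  · simp [← h0]
  rcases ((hq u).1 v).eq_or_lt with h0 | hv
  · simp [← h0]
  rcases ((hw v).1 z).eq_or_lt with h0 | hz
  · simp [← h0]
  rw [h u v z hu hv hz]

theorem chain_sum_le (hp : p ∈ stdSimplex ℝ U) (hq : ∀ u, q u ∈ stdSimplex ℝ V)
    (hw : ∀ v, w v ∈ stdSimplex ℝ Z) {F G : U → V → Z → ℝ}
    (h : ∀ u v z, 0 < p u → 0 < q u v → 0 < w v z → F u v z ≤ G u v z) :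
    ∑ u, ∑ v, ∑ z, p u * q u v * w v z * F u v z ≤
      ∑ u, ∑ v, ∑ z, p u * q u v * w v z * G u v z := by
  refine Finset.sum_le_sum fun u _ => Finset.sum_le_sum fun v _ =>
    Finset.sum_le_sum fun z _ => ?_
  rcases (hp.1 u).eq_or_lt with h0 | hu
  · simp [← h0]
  rcases ((hq u).1 v).eq_or_lt with h0 | hv
  · simp [← h0]
  rcases ((hw v).1 z).eq_or_lt with h0 | hz
  · simp [← h0]
  exact mul_le_mul_of_nonneg_left (h u v z hu hv hz) (by positivity)

theorem chain_sum_one (hp : p ∈ stdSimplex ℝ U) (hq : ∀ u, q u ∈ stdSimplex ℝ V)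
    (hw : ∀ v, w v ∈ stdSimplex ℝ Z) : ∑ u, ∑ v, ∑ z, p u * q u v * w v z = 1 := by
  simp_rw [← Finset.mul_sum, (hw _).2, mul_one, ← Finset.mul_sum, (hq _).2, mul_one, hp.2]

theorem infoV_eq (hp : p ∈ stdSimplex ℝ U) (hq : ∀ u, q u ∈ stdSimplex ℝ V)
    (hw : ∀ v, w v ∈ stdSimplex ℝ Z) : infoV p q w = infoU p q w + condInfo p q w := by
  unfold infoV infoU condInfo
  simp_rw [← Finset.sum_add_distrib, ← mul_add]
  refine chain_sum_congr hp hq hw fun u v z hu hv hz => ?_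
  have h1 := cloudOut_pos hq hw hv hz
  have h2 := out_pos hp hq hw hu hv hz
  rw [Real.log_div hz.ne' h2.ne', Real.log_div h1.ne' h2.ne', Real.log_div hz.ne' h1.ne']
  ring

theorem condInfo_nonneg (hp : p ∈ stdSimplex ℝ U) (hq : ∀ u, q u ∈ stdSimplex ℝ V)
    (hw : ∀ v, w v ∈ stdSimplex ℝ Z) : 0 ≤ condInfo p q w := by
  unfold condInfo
  refine Finset.sum_nonneg fun u _ => ?_
  simp_rw [mul_assoc, ← Finset.mul_sum]
  refine mul_nonneg (hp.1 u) (Finset.sum_nonneg fun v _ => ?_)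
  rcases ((hq u).1 v).eq_or_lt with h0 | hv
  · simp [← h0]
  exact mul_nonneg hv.le (sum_mul_log_div_nonneg _ _ _ (fun z _ => (hw v).1 z)
    (fun z _ => (cloudOut_mem_stdSimplex hq hw u).1 z) (fun z _ hz => cloudOut_pos hq hw hv hz)
    (by rw [(hw v).2, (cloudOut_mem_stdSimplex hq hw u).2]))

/-- I(U;Z) is the conditional information of the chain from a one-point space through U to Z. -/
theorem infoU_nonneg (hp : p ∈ stdSimplex ℝ U) (hq : ∀ u, q u ∈ stdSimplex ℝ V)
    (hw : ∀ v, w v ∈ stdSimplex ℝ Z) : 0 ≤ infoU p q w := by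
  have h := condInfo_nonneg (q := fun _ : Unit => p) (p := fun _ => 1) (by simp [stdSimplex])
    (fun _ => hp) (cloudOut_mem_stdSimplex hq hw)
  refine h.trans (le_of_eq ?_)
  simp only [condInfo, infoU, Finset.univ_unique, Finset.sum_singleton, one_mul]
  refine Finset.sum_congr rfl fun u _ => ?_
  rw [Finset.sum_comm]
  refine Finset.sum_congr rfl fun z _ => ?_
  simp_rw [← Finset.sum_mul, mul_assoc (p u), ← Finset.mul_sum]
  exact (mul_assoc (p u) (cloudOut q w u z) _).symm

variable {P : PMF (U × V × Z)}

/-- Translates the entropy definition, in bits, into the kernel expression, in nats; this and the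
next two lemmas are the only link needed between the theorem's quantities and the coding bounds. -/
theorem mutualInfo_chain_right (hp : p ∈ stdSimplex ℝ U) (hq : ∀ u, q u ∈ stdSimplex ℝ V)
    (hw : ∀ v, w v ∈ stdSimplex ℝ Z)
    (hP : ∀ u v z, (P (u, v, z)).toReal = p u * q u v * w v z) :
    mutualInfo P (fun t => t.2.1) (fun t => t.2.2) = infoV p q w / Real.log 2 := by
  classical
  have h1 : ∀ v, ((P.map fun t => t.2.1) v).toReal = ∑ u, p u * q u v := fun v => by
    rw [toReal_map_apply]
    simp [Fintype.sum_prod_type, hP, Finset.sum_ite_irrel, ← Finset.mul_sum, (hw _).2]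
  have h2 : ∀ z, ((P.map fun t => t.2.2) z).toReal = out p q w z := fun z => by
    rw [toReal_map_apply]
    simp [Fintype.sum_prod_type, hP, out, cloudOut, Finset.mul_sum, mul_assoc]
  have h3 : ∀ v z, ((P.map fun t => (t.2.1, t.2.2)) (v, z)).toReal =
      (∑ u, p u * q u v) * w v z := fun v z => by
    rw [toReal_map_apply]
    simp [Fintype.sum_prod_type, hP, Finset.sum_mul]
  rw [mutualInfo_eq]
  simp only [Fintype.sum_prod_type, hP, h1, h2, h3]
  congr 1
  refine chain_sum_congr hp hq hw fun u v z hu hv hz => ?_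
  have h4 : 0 < ∑ u, p u * q u v := (mul_pos hu hv).trans_le
    (Finset.single_le_sum (f := fun u => p u * q u v)
      (fun u _ => mul_nonneg (hp.1 u) ((hq u).1 v)) (Finset.mem_univ u))
  rw [Real.log_div hz.ne' (out_pos hp hq hw hu hv hz).ne', Real.log_mul h4.ne' hz.ne']
  ring

theorem mutualInfo_chain_left (hp : p ∈ stdSimplex ℝ U) (hq : ∀ u, q u ∈ stdSimplex ℝ V)
    (hw : ∀ v, w v ∈ stdSimplex ℝ Z)
    (hP : ∀ u v z, (P (u, v, z)).toReal = p u * q u v * w v z) :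
    mutualInfo P (fun t => t.1) (fun t => t.2.2) = infoU p q w / Real.log 2 := by
  classical
  have h1 : ∀ u, ((P.map fun t => t.1) u).toReal = p u := fun u => by
    rw [toReal_map_apply, Fintype.sum_prod_type, Finset.sum_eq_single u]
    · simp [Fintype.sum_prod_type, hP, ← Finset.mul_sum, (hw _).2, (hq _).2]
    · intro u' _ hu'; simp [hu']
    · simp
  have h2 : ∀ z, ((P.map fun t => t.2.2) z).toReal = out p q w z := fun z => by
    rw [toReal_map_apply]
    simp [Fintype.sum_prod_type, hP, out, cloudOut, Finset.mul_sum, mul_assoc]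
  have h3 : ∀ u z, ((P.map fun t => (t.1, t.2.2)) (u, z)).toReal =
      p u * cloudOut q w u z := fun u z => by
    rw [toReal_map_apply, Fintype.sum_prod_type, Finset.sum_eq_single u]
    · simp [Fintype.sum_prod_type, hP, cloudOut, Finset.mul_sum, mul_assoc]
    · intro u' _ hu'; simp [hu']
    · simp
  rw [mutualInfo_eq]
  simp only [Fintype.sum_prod_type, hP, h1, h2, h3]
  congr 1
  refine chain_sum_congr hp hq hw fun u v z hu hv hz => ?_
  have h4 := cloudOut_pos hq hw hv hz
  rw [Real.log_div h4.ne' (out_pos hp hq hw hu hv hz).ne', Real.log_mul hu.ne' h4.ne']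
  ring

theorem condMutualInfo_chain (hp : p ∈ stdSimplex ℝ U) (hq : ∀ u, q u ∈ stdSimplex ℝ V)
    (hw : ∀ v, w v ∈ stdSimplex ℝ Z)
    (hP : ∀ u v z, (P (u, v, z)).toReal = p u * q u v * w v z) :
    condMutualInfo P (fun t => t.2.1) (fun t => t.2.2) (fun t => t.1) =
      condInfo p q w / Real.log 2 := by
  classical
  have h1 : ∀ u, ((P.map fun t => t.1) u).toReal = p u := fun u => by
    rw [toReal_map_apply, Fintype.sum_prod_type, Finset.sum_eq_single u]
    · simp [Fintype.sum_prod_type, hP, ← Finset.mul_sum, (hw _).2, (hq _).2]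
    · intro u' _ hu'; simp [hu']
    · simp
  have h2 : ∀ u v, ((P.map fun t => (t.2.1, t.1)) (v, u)).toReal = p u * q u v := fun u v => by
    rw [toReal_map_apply]
    simp [Fintype.sum_prod_type, hP, ite_and, Finset.sum_ite_irrel, ← Finset.mul_sum, (hw _).2]
  have h3 : ∀ u z, ((P.map fun t => (t.2.2, t.1)) (z, u)).toReal =
      p u * cloudOut q w u z := fun u z => by
    rw [toReal_map_apply, Fintype.sum_prod_type, Finset.sum_eq_single u]
    · simp [Fintype.sum_prod_type, hP, cloudOut, Finset.mul_sum, mul_assoc]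
    · intro u' _ hu'; simp [hu']
    · simp
  have h4 : ∀ u v z, ((P.map fun t => (t.2.1, t.2.2, t.1)) (v, z, u)).toReal =
      p u * q u v * w v z := fun u v z => by
    rw [toReal_map_apply]
    simp [Fintype.sum_prod_type, hP, ite_and]
  rw [condMutualInfo_eq]
  simp only [Fintype.sum_prod_type, hP, h1, h2, h3, h4]
  congr 1
  refine chain_sum_congr hp hq hw fun u v z hu hv hz => ?_
  have h5 := cloudOut_pos hq hw hv hz
  rw [Real.log_div hz.ne' h5.ne', Real.log_mul (mul_pos hu hv).ne' hz.ne',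
    Real.log_mul hu.ne' h5.ne', Real.log_mul hu.ne' hv.ne']
  ring

end Chain

/-! ### Block kernels and the bounds on the averaged code -/

section Product

variable {U V Z : Type*} {n : ℕ}

/-- The memoryless extension of the kernel `w` to blocks of length `n`. -/
def blockKernel (n : ℕ) (w : V → Z → ℝ) (v : Fin n → V) (z : Fin n → Z) : ℝ :=
  ∏ i, w (v i) (z i)

/-- The law of `n` independent variables of law `p`. -/
def blockLaw (n : ℕ) (p : U → ℝ) (u : Fin n → U) : ℝ :=
  ∏ i, p (u i)

variable {p : U → ℝ} {q : U → V → ℝ} {w : V → Z → ℝ}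

theorem blockKernel_mem_stdSimplex [Fintype Z] (hw : ∀ v, w v ∈ stdSimplex ℝ Z)
    (v : Fin n → V) :
    blockKernel n w v ∈ stdSimplex ℝ (Fin n → Z) :=
  ⟨fun _ => Finset.prod_nonneg fun _ _ => (hw _).1 _,
    sum_pi_prod_eq_one (fun i => w (v i)) fun i => (hw (v i)).2⟩

theorem blockKernel_pos_iff [Fintype Z] (hw : ∀ v, w v ∈ stdSimplex ℝ Z) {v : Fin n → V}
    {z : Fin n → Z} :
    0 < blockKernel n w v z ↔ ∀ i, 0 < w (v i) (z i) := by
  refine ⟨fun h i => ((hw _).1 _).lt_of_ne' fun h0 => h.ne' ?_,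
    fun h => Finset.prod_pos fun i _ => h i⟩
  exact Finset.prod_eq_zero (Finset.mem_univ i) h0

/-- Marginals of memoryless kernels are again memoryless, so block information densities are sums of
single-letter ones. -/
theorem cloudOut_blockKernel [Fintype V] (u : Fin n → U) (z : Fin n → Z) :
    cloudOut (blockKernel n q) (blockKernel n w) u z = ∏ i, cloudOut q w (u i) (z i) := by
  unfold cloudOut blockKernel
  simp_rw [← Finset.prod_mul_distrib]
  exact sum_pi_prod fun i v => q (u i) v * w v (z i)

theorem out_blockKernel [Fintype U] [Fintype V] (z : Fin n → Z) :
    out (blockLaw n p) (blockKernel n q) (blockKernel n w) z = ∏ i, out p q w (z i) := by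
  unfold out blockLaw
  simp_rw [cloudOut_blockKernel, ← Finset.prod_mul_distrib]
  exact sum_pi_prod fun i u => p u * cloudOut q w u (z i)

variable [Fintype U] [Fintype V] [Fintype Z]

theorem blockLaw_mem_stdSimplex (hp : p ∈ stdSimplex ℝ U) :
    blockLaw n p ∈ stdSimplex ℝ (Fin n → U) :=
  ⟨fun _ => Finset.prod_nonneg fun _ _ => hp.1 _, sum_pi_prod_eq_one (fun _ => p) fun _ => hp.2⟩

theorem blockLaw_pos_iff (hp : p ∈ stdSimplex ℝ U) {u : Fin n → U} :
    0 < blockLaw n p u ↔ ∀ i, 0 < p (u i) := by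
  refine ⟨fun h i => (hp.1 _).lt_of_ne' fun h0 => h.ne' ?_, fun h => Finset.prod_pos fun i _ => h i⟩
  exact Finset.prod_eq_zero (Finset.mem_univ i) h0

theorem log_prod_div_prod {f g : Fin n → ℝ} (hf : ∀ i, 0 < f i) (hg : ∀ i, 0 < g i) :
    Real.log ((∏ i, f i) / ∏ i, g i) = ∑ i, Real.log (f i / g i) := by
  rw [← Finset.prod_div_distrib, Real.log_prod fun i _ => (div_pos (hf i) (hg i)).ne']

theorem log_max_one {a : ℝ} (ha : 0 < a) : Real.log (max 1 a) = max 0 (Real.log a) := by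
  rcases le_total 1 a with h | h
  · rw [max_eq_right h, max_eq_right (Real.log_nonneg h)]
  · rw [max_eq_left h, max_eq_left (Real.log_nonpos ha.le h), Real.log_one]

/-- Each of the three summands is at most max(1, a) · max(1, b). -/
theorem log_one_add_add_le {a b : ℝ} (ha : 0 < a) (hb : 0 < b) :
    Real.log (1 + a + b) ≤ Real.log 3 + max 0 (Real.log a) + max 0 (Real.log b) := by
  have h1 := le_max_left 1 a
  have h2 := le_max_left 1 b
  rw [← log_max_one ha, ← log_max_one hb, ← Real.log_mul (by norm_num) (by positivity),
    ← Real.log_mul (by positivity) (by positivity)]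
  refine Real.log_le_log (by positivity) ?_
  nlinarith [le_max_right 1 a, le_max_right 1 b]

/-- The positive part of a normalized information density is controlled by its deviation. -/
theorem max_zero_log_le {n : ℕ} {f g : Fin n → ℝ} (hf : ∀ i, 0 < f i) (hg : ∀ i, 0 < g i)
    {c : ℝ} (hc : 0 < c) (μ : ℝ) :
    max 0 (Real.log ((∏ i, f i) / (c * ∏ i, g i))) ≤
      |∑ i, Real.log (f i / g i) - n * μ| + max 0 (n * μ - Real.log c) := by
  have h1 : 0 < ∏ i, f i := Finset.prod_pos fun i _ => hf i
  have h2 : 0 < ∏ i, g i := Finset.prod_pos fun i _ => hg i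
  rw [mul_comm c, ← div_div, Real.log_div (div_pos h1 h2).ne' hc.ne', log_prod_div_prod hf hg]
  refine max_le (by positivity) ?_
  have := le_abs_self (∑ i, Real.log (f i / g i) - n * μ)
  have := le_max_right 0 (n * μ - Real.log c)
  linarith

/-- Divided by J·K·`out`, the conditional mean is at most 1 + w/(J·K·`out`) + `cloudOut`/(J·`out`).
The logarithm is therefore large only where the density of I(V;Z) exceeds log(J·K) or that of I(U;Z)
exceeds log J, and these densities fluctuate by O(√n) around n times their means. -/
theorem exists_weak_bound (hp : p ∈ stdSimplex ℝ U) (hq : ∀ u, q u ∈ stdSimplex ℝ V)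
    (hw : ∀ v, w v ∈ stdSimplex ℝ Z) :
    ∃ c : ℝ, 0 ≤ c ∧ ∀ n J K : ℕ, 1 ≤ J → 1 ≤ K →
      ∑ u, ∑ v, ∑ z, blockLaw n p u * blockKernel n q u v * blockKernel n w v z *
        Real.log (condMean (blockLaw n p) (blockKernel n q) J K (fun v => blockKernel n w v z) u v /
          (J * K * out (blockLaw n p) (blockKernel n q) (blockKernel n w) z)) ≤
      Real.log 3 + c * √n + max 0 (n * infoV p q w - Real.log (J * K)) +
        max 0 (n * infoU p q w - Real.log J) := by
  obtain ⟨c₁, hc₁, h₁⟩ := exists_deviation_bound p q w hp hq hw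
    (fun _ v z => Real.log (w v z / out p q w z)) _ rfl
  obtain ⟨c₂, hc₂, h₂⟩ := exists_deviation_bound p q w hp hq hw
    (fun u _ z => Real.log (cloudOut q w u z / out p q w z)) _ rfl
  refine ⟨c₁ + c₂, by positivity, fun n J K hJ hK => ?_⟩
  have hJ' : (1 : ℝ) ≤ J := by exact_mod_cast hJ
  have hK' : (1 : ℝ) ≤ K := by exact_mod_cast hK
  set b := Real.log 3 + max 0 (n * infoV p q w - Real.log (J * K)) +
        max 0 (n * infoU p q w - Real.log J)
  have key := chain_sum_le (blockLaw_mem_stdSimplex (n := n) hp) (blockKernel_mem_stdSimplex hq)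
    (blockKernel_mem_stdSimplex hw) (F := fun u v z =>
      Real.log (condMean (blockLaw n p) (blockKernel n q) J K (fun v => blockKernel n w v z) u v /
          (J * K * out (blockLaw n p) (blockKernel n q) (blockKernel n w) z)))
    (G := fun u v z => b +
      |∑ i, Real.log (w (v i) (z i) / out p q w (z i)) - n * infoV p q w| +
      |∑ i, Real.log (cloudOut q w (u i) (z i) / out p q w (z i)) - n * infoU p q w|)
    fun u v z hu hv hz => ?_
  · refine key.trans ?_
    simp_rw [mul_add, Finset.sum_add_distrib, ← Finset.sum_mul]
    rw [chain_sum_one (blockLaw_mem_stdSimplex (n := n) hp) (blockKernel_mem_stdSimplex hq)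
      (blockKernel_mem_stdSimplex hw), one_mul]
    have e₁ := h₁ n
    have e₂ := h₂ n
    simp only [blockLaw, blockKernel, infoV, infoU, b] at *
    linarith
  · have hu' := (blockLaw_pos_iff hp).1 hu
    have hv' := (blockKernel_pos_iff hq).1 hv
    have hz' := (blockKernel_pos_iff hw).1 hz
    have ho : ∀ i, 0 < out p q w (z i) := fun i => out_pos hp hq hw (hu' i) (hv' i) (hz' i)
    have hcl : ∀ i, 0 < cloudOut q w (u i) (z i) := fun i => cloudOut_pos hq hw (hv' i) (hz' i)
    have hO : 0 < ∏ i, out p q w (z i) := Finset.prod_pos fun i _ => ho i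
    have hC : 0 < ∏ i, cloudOut q w (u i) (z i) := Finset.prod_pos fun i _ => hcl i
    have m₁ := max_zero_log_le hz' ho (c := (J * K : ℝ)) (by positivity) (infoV p q w)
    have m₂ := max_zero_log_le hcl ho (c := (J : ℝ)) (by positivity) (infoU p q w)
    have hlog := log_one_add_add_le
      (a := (∏ i, w (v i) (z i)) / (J * K * ∏ i, out p q w (z i)))
      (b := (∏ i, cloudOut q w (u i) (z i)) / (J * ∏ i, out p q w (z i)))
      (div_pos hz (by positivity)) (by positivity)
    have hcm : condMean (blockLaw n p) (blockKernel n q) J K (fun v => blockKernel n w v z) u v =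
        blockKernel n w v z + (K - 1) * (∏ i, cloudOut q w (u i) (z i)) +
          (J - 1) * K * ∏ i, out p q w (z i) := by
      rw [← cloudOut_blockKernel, ← out_blockKernel]; rfl
    have hle : condMean (blockLaw n p) (blockKernel n q) J K (fun v => blockKernel n w v z) u v /
          (J * K * out (blockLaw n p) (blockKernel n q) (blockKernel n w) z) ≤
        1 + (∏ i, w (v i) (z i)) / (J * K * ∏ i, out p q w (z i)) +
          (∏ i, cloudOut q w (u i) (z i)) / (J * ∏ i, out p q w (z i)) := by
      rw [hcm, out_blockKernel, div_le_iff₀ (by positivity)]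
      have e : (1 + (∏ i, w (v i) (z i)) / (J * K * ∏ i, out p q w (z i)) +
          (∏ i, cloudOut q w (u i) (z i)) / (J * ∏ i, out p q w (z i))) *
          (J * K * ∏ i, out p q w (z i)) = J * K * (∏ i, out p q w (z i)) +
          (∏ i, w (v i) (z i)) + K * ∏ i, cloudOut q w (u i) (z i) := by
        field_simp
      rw [e]
      have : 0 ≤ K * ∏ i, out p q w (z i) := by positivity
      unfold blockKernel
      nlinarith
    have hpos : 0 < condMean (blockLaw n p) (blockKernel n q) J K
          (fun v => blockKernel n w v z) u v /
          (J * K * out (blockLaw n p) (blockKernel n q) (blockKernel n w) z) := by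
      rw [out_blockKernel]
      exact div_pos (condMean_pos (blockLaw_mem_stdSimplex hp) (blockKernel_mem_stdSimplex hq) hJ hK
        (fun v => (blockKernel_mem_stdSimplex hw v).1 z) u hz) (by positivity)
    have := Real.log_le_log hpos hle
    simp only [b]
    linarith

/-- Resolvability inside one cloud: with J = 1 the term from other clouds vanishes and only the
density of I(V;Z|U) has to be covered by log K. -/
theorem exists_strong_bound (hp : p ∈ stdSimplex ℝ U) (hq : ∀ u, q u ∈ stdSimplex ℝ V)
    (hw : ∀ v, w v ∈ stdSimplex ℝ Z) :
    ∃ c : ℝ, 0 ≤ c ∧ ∀ n K : ℕ, 1 ≤ K →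
      ∑ u, ∑ v, ∑ z, blockLaw n p u * blockKernel n q u v * blockKernel n w v z *
        Real.log (condMean (blockLaw n p) (blockKernel n q) 1 K (fun v => blockKernel n w v z) u v /
          (K * cloudOut (blockKernel n q) (blockKernel n w) u z)) ≤
      Real.log 3 + c * √n + max 0 (n * condInfo p q w - Real.log K) := by
  obtain ⟨c, hc, h⟩ := exists_deviation_bound p q w hp hq hw
    (fun u v z => Real.log (w v z / cloudOut q w u z)) _ rfl
  refine ⟨c, hc, fun n K hK => ?_⟩
  have hK' : (1 : ℝ) ≤ K := by exact_mod_cast hK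
  set b := Real.log 3 + max 0 (n * condInfo p q w - Real.log K)
  have key := chain_sum_le (blockLaw_mem_stdSimplex (n := n) hp) (blockKernel_mem_stdSimplex hq)
    (blockKernel_mem_stdSimplex hw) (F := fun u v z =>
      Real.log (condMean (blockLaw n p) (blockKernel n q) 1 K (fun v => blockKernel n w v z) u v /
          (K * cloudOut (blockKernel n q) (blockKernel n w) u z)))
    (G := fun u v z => b +
      |∑ i, Real.log (w (v i) (z i) / cloudOut q w (u i) (z i)) - n * condInfo p q w|)
    fun u v z hu hv hz => ?_
  · refine key.trans ?_
    simp_rw [mul_add, Finset.sum_add_distrib, ← Finset.sum_mul]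
    rw [chain_sum_one (blockLaw_mem_stdSimplex (n := n) hp) (blockKernel_mem_stdSimplex hq)
      (blockKernel_mem_stdSimplex hw), one_mul]
    have e := h n
    simp only [blockLaw, blockKernel, condInfo, b] at *
    linarith
  · have hv' := (blockKernel_pos_iff hq).1 hv
    have hz' := (blockKernel_pos_iff hw).1 hz
    have hcl : ∀ i, 0 < cloudOut q w (u i) (z i) := fun i => cloudOut_pos hq hw (hv' i) (hz' i)
    have hC : 0 < ∏ i, cloudOut q w (u i) (z i) := Finset.prod_pos fun i _ => hcl i
    have m := max_zero_log_le hz' hcl (c := (K : ℝ)) (by positivity) (condInfo p q w)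
    -- Taking b = 1 reuses the three-term bound; the extra 1 absorbs the contribution of the other
    -- satellites.
    have hlog := log_one_add_add_le
      (a := (∏ i, w (v i) (z i)) / (K * ∏ i, cloudOut q w (u i) (z i))) (b := 1)
      (div_pos hz (by positivity)) one_pos
    rw [Real.log_one, max_self, add_zero] at hlog
    have hcm : condMean (blockLaw n p) (blockKernel n q) 1 K (fun v => blockKernel n w v z) u v =
        blockKernel n w v z + (K - 1) * ∏ i, cloudOut q w (u i) (z i) := by
      rw [← cloudOut_blockKernel]
      simp [condMean, cloudOut]
    have hle : condMean (blockLaw n p) (blockKernel n q) 1 K (fun v => blockKernel n w v z) u v /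
          (K * cloudOut (blockKernel n q) (blockKernel n w) u z) ≤
        1 + (∏ i, w (v i) (z i)) / (K * ∏ i, cloudOut q w (u i) (z i)) + 1 := by
      rw [hcm, cloudOut_blockKernel, div_le_iff₀ (by positivity)]
      have e : (1 + (∏ i, w (v i) (z i)) / (K * ∏ i, cloudOut q w (u i) (z i)) + 1) *
          (K * ∏ i, cloudOut q w (u i) (z i)) = 2 * K * (∏ i, cloudOut q w (u i) (z i)) +
          ∏ i, w (v i) (z i) := by
        field_simp
        ring
      rw [e]
      have : 0 ≤ K * ∏ i, cloudOut q w (u i) (z i) := by positivity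
      unfold blockKernel
      nlinarith
    have hpos : 0 < condMean (blockLaw n p) (blockKernel n q) 1 K
          (fun v => blockKernel n w v z) u v /
          (K * cloudOut (blockKernel n q) (blockKernel n w) u z) := by
      rw [cloudOut_blockKernel]
      exact div_pos (condMean_pos (blockLaw_mem_stdSimplex hp) (blockKernel_mem_stdSimplex hq)
        le_rfl hK (fun v => (blockKernel_mem_stdSimplex hw v).1 z) u hz) (by positivity)
    have := Real.log_le_log hpos hle
    simp only [b]
    linarith

/-- If the information density is not below its mean `n * μ` by more than `n * δ / 2`, then
`exp (n * (μ - δ))` competitors contribute little to the error. -/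
theorem mul_prod_le_of_deviation {n : ℕ} {f g : Fin n → ℝ} (hf : ∀ i, 0 < f i)
    (hg : ∀ i, 0 < g i) {N μ δ : ℝ} (hN : N ≤ Real.exp (n * (μ - δ)))
    (hd : |∑ i, Real.log (f i / g i) - n * μ| ≤ n * δ / 2) :
    N * ∏ i, g i ≤ Real.exp (-(n * δ / 2)) * ∏ i, f i := by
  have h1 : 0 < ∏ i, f i := Finset.prod_pos fun i _ => hf i
  have h2 : 0 < ∏ i, g i := Finset.prod_pos fun i _ => hg i
  have h3 := (abs_le.1 hd).1
  rw [← log_prod_div_prod hf hg] at h3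
  have h4 : Real.exp (n * μ - n * δ / 2) ≤ (∏ i, f i) / ∏ i, g i := by
    rw [← Real.le_log_iff_exp_le (div_pos h1 h2)]
    linarith
  rw [le_div_iff₀ h2] at h4
  calc N * ∏ i, g i ≤ Real.exp (n * (μ - δ)) * ∏ i, g i := by gcongr
    _ = Real.exp (-(n * δ / 2)) * (Real.exp (n * μ - n * δ / 2) * ∏ i, g i) := by
      rw [← mul_assoc, ← Real.exp_add]
      congr 2
      ring
    _ ≤ _ := by gcongr

/-- The posterior of the sent codeword competes with K - 1 satellites of its cloud, governed by
I(V;Y|U), and with (J - 1)K codewords of other clouds, governed by I(V;Y). Counting competitors, not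
codewords, keeps the hypotheses true for a layer of size one even when the backed-off rate is
negative. -/
theorem exists_error_bound (hp : p ∈ stdSimplex ℝ U) (hq : ∀ u, q u ∈ stdSimplex ℝ V)
    (hw : ∀ v, w v ∈ stdSimplex ℝ Z) :
    ∃ c : ℝ, 0 ≤ c ∧ ∀ (n J K : ℕ) (δ : ℝ), 1 ≤ n → 1 ≤ J → 1 ≤ K → 0 < δ →
      (K - 1 : ℝ) ≤ Real.exp (n * (condInfo p q w - δ)) →
      ((J - 1) * K : ℝ) ≤ Real.exp (n * (infoV p q w - δ)) →
      ∑ u, ∑ v, ∑ z, blockLaw n p u * blockKernel n q u v * blockKernel n w v z *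
        (1 - blockKernel n w v z /
          condMean (blockLaw n p) (blockKernel n q) J K (fun v => blockKernel n w v z) u v) ≤
      2 * Real.exp (-(n * δ / 2)) + c * √n / (n * δ / 2) := by
  obtain ⟨c₁, hc₁, h₁⟩ := exists_deviation_bound p q w hp hq hw
    (fun _ v z => Real.log (w v z / out p q w z)) _ rfl
  obtain ⟨c₂, hc₂, h₂⟩ := exists_deviation_bound p q w hp hq hw
    (fun u v z => Real.log (w v z / cloudOut q w u z)) _ rfl
  refine ⟨c₁ + c₂, by positivity, fun n J K δ hn hJ hK hδ hK₁ hJ₁ => ?_⟩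
  have hn' : (1 : ℝ) ≤ n := by exact_mod_cast hn
  have hJ' : (1 : ℝ) ≤ J := by exact_mod_cast hJ
  have hK' : (1 : ℝ) ≤ K := by exact_mod_cast hK
  have hτ : 0 < n * δ / 2 := by positivity
  set τ := n * δ / 2 with hτdef
  have key := chain_sum_le (blockLaw_mem_stdSimplex (n := n) hp) (blockKernel_mem_stdSimplex hq)
    (blockKernel_mem_stdSimplex hw) (F := fun u v z => 1 - blockKernel n w v z /
          condMean (blockLaw n p) (blockKernel n q) J K (fun v => blockKernel n w v z) u v)
    (G := fun u v z => 2 * Real.exp (-τ) +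
      |∑ i, Real.log (w (v i) (z i) / out p q w (z i)) - n * infoV p q w| * τ⁻¹ +
      |∑ i, Real.log (w (v i) (z i) / cloudOut q w (u i) (z i)) - n * condInfo p q w| * τ⁻¹)
    fun u v z hu hv hz => ?_
  · refine key.trans ?_
    simp_rw [mul_add, Finset.sum_add_distrib, ← mul_assoc, ← Finset.sum_mul]
    rw [chain_sum_one (blockLaw_mem_stdSimplex (n := n) hp) (blockKernel_mem_stdSimplex hq)
      (blockKernel_mem_stdSimplex hw), one_mul, add_mul, add_div, ← add_assoc]
    exact add_le_add (add_le_add le_rfl (mul_le_mul_of_nonneg_right (h₁ n) (by positivity)))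
      (mul_le_mul_of_nonneg_right (h₂ n) (by positivity))
  · have hu' := (blockLaw_pos_iff hp).1 hu
    have hv' := (blockKernel_pos_iff hq).1 hv
    have hz' := (blockKernel_pos_iff hw).1 hz
    have ho : ∀ i, 0 < out p q w (z i) := fun i => out_pos hp hq hw (hu' i) (hv' i) (hz' i)
    have hcl : ∀ i, 0 < cloudOut q w (u i) (z i) := fun i => cloudOut_pos hq hw (hv' i) (hz' i)
    have hx₀ := condMean_pos (blockLaw_mem_stdSimplex hp) (blockKernel_mem_stdSimplex hq) hJ hK
        (fun v => (blockKernel_mem_stdSimplex hw v).1 z) u hz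
    have hcm : condMean (blockLaw n p) (blockKernel n q) J K (fun v => blockKernel n w v z) u v =
        blockKernel n w v z + (K - 1) * (∏ i, cloudOut q w (u i) (z i)) +
          (J - 1) * K * ∏ i, out p q w (z i) := by
      rw [← cloudOut_blockKernel, ← out_blockKernel]; rfl
    have hO : 0 < ∏ i, out p q w (z i) := Finset.prod_pos fun i _ => ho i
    have hC : 0 < ∏ i, cloudOut q w (u i) (z i) := Finset.prod_pos fun i _ => hcl i
    set x₀ := condMean (blockLaw n p) (blockKernel n q) J K (fun v => blockKernel n w v z) u v
    set d₁ := |∑ i, Real.log (w (v i) (z i) / out p q w (z i)) - n * infoV p q w| with hd₁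
    set d₂ := |∑ i, Real.log (w (v i) (z i) / cloudOut q w (u i) (z i)) - n * condInfo p q w|
      with hd₂
    have hd₁0 : 0 ≤ d₁ * τ⁻¹ := by positivity
    have hd₂0 : 0 ≤ d₂ * τ⁻¹ := by positivity
    have he := Real.exp_pos (-τ)
    have hle1 : 1 - blockKernel n w v z / x₀ ≤ 1 := by
      have := div_pos hz hx₀
      linarith
    -- If both deviations are at most τ, each group of competitors weighs at most exp(-τ) times the
    -- sent codeword. Otherwise the trivial bound 1 is at most d₁/τ or d₂/τ, which is Markov's
    -- inequality pointwise.
    by_cases hb₁ : d₁ ≤ τ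
    · by_cases hb₂ : d₂ ≤ τ
      · have e₁ := mul_prod_le_of_deviation hz' ho hJ₁ hb₁
        have e₂ := mul_prod_le_of_deviation hz' hcl hK₁ hb₂
        have : 1 - blockKernel n w v z / x₀ ≤ 2 * Real.exp (-τ) := by
          rw [one_sub_div hx₀.ne', div_le_iff₀ hx₀]
          have h1 : x₀ - blockKernel n w v z ≤ 2 * Real.exp (-τ) * blockKernel n w v z := by
            rw [hcm]
            simp only [blockKernel]
            linarith
          refine h1.trans (mul_le_mul_of_nonneg_left ?_ (by positivity))
          rw [hcm]
          have := mul_nonneg (sub_nonneg.2 hK') hC.le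
          have := mul_nonneg (mul_nonneg (sub_nonneg.2 hJ') (zero_le_one.trans hK')) hO.le
          linarith
        linarith
      · have : 1 ≤ d₂ * τ⁻¹ := by
          rw [← div_eq_mul_inv, one_le_div hτ]; exact (not_le.1 hb₂).le
        linarith
    · have : 1 ≤ d₁ * τ⁻¹ := by
        rw [← div_eq_mul_inv, one_le_div hτ]; exact (not_le.1 hb₁).le
      linarith

end Product

/-! ### Codebook averages of divergence and error for arbitrary kernels -/

section OneShot

/-- The log sum inequality. -/
theorem sum_mul_log_sum_div_sum_le {ι : Type*} (s : Finset ι) (f g : ι → ℝ) (hf : ∀ i ∈ s, 0 ≤ f i)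
    (hg : ∀ i ∈ s, 0 ≤ g i) (hfg : ∀ i ∈ s, 0 < f i → 0 < g i) :
    (∑ i ∈ s, f i) * Real.log ((∑ i ∈ s, f i) / ∑ i ∈ s, g i) ≤
      ∑ i ∈ s, f i * Real.log (f i / g i) := by
  rcases (Finset.sum_nonneg hf).eq_or_lt with h0 | hF
  · rw [← h0, zero_mul]
    have h1 := (Finset.sum_eq_zero_iff_of_nonneg hf).1 h0.symm
    rw [Finset.sum_eq_zero fun i hi => by rw [h1 i hi, zero_mul]]
  obtain ⟨i₀, hi₀, hne⟩ := Finset.exists_ne_zero_of_sum_ne_zero hF.ne'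
  have hG : 0 < ∑ i ∈ s, g i := (hfg i₀ hi₀ ((hf i₀ hi₀).lt_of_ne' hne)).trans_le
    (Finset.single_le_sum hg hi₀)
  set c := (∑ i ∈ s, f i) / ∑ i ∈ s, g i with hc
  have hc0 : 0 < c := div_pos hF hG
  have h := sum_mul_log_div_nonneg s f (fun i => g i * c) hf
    (fun i hi => mul_nonneg (hg i hi) hc0.le)
    (fun i hi h => mul_pos (hfg i hi h) hc0)
    (by rw [← Finset.sum_mul, hc, mul_div_cancel₀ _ hG.ne'])
  rw [← sub_nonneg, Finset.sum_mul, ← Finset.sum_sub_distrib]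
  refine h.trans (le_of_eq (Finset.sum_congr rfl fun i hi => ?_))
  rcases (hf i hi).eq_or_lt with h0 | h0
  · simp [← h0]
  have hg0 := hfg i hi h0
  rw [Real.log_div h0.ne' (mul_pos hg0 hc0).ne', Real.log_mul hg0.ne' hc0.ne',
    Real.log_div h0.ne' hg0.ne']
  ring

variable {U V Z M₁ A₂ B₂ Ra Rb : Type*} [Fintype U] [Fintype V] [Fintype Z] [Fintype M₁]
  [Fintype A₂] [Fintype B₂] [Fintype Ra] [Fintype Rb] [DecidableEq M₁] [DecidableEq A₂]
  [DecidableEq B₂] [DecidableEq Ra] [DecidableEq Rb]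
  {p : U → ℝ} {q : U → V → ℝ} {w : V → Z → ℝ}

/-- Mean divergence, over the random codebook, of the output given a message pair from the
reference output law. -/
theorem sum_bookWeight_mul_weakDivergence_le [Nonempty Ra] [Nonempty Rb]
    (hp : p ∈ stdSimplex ℝ U) (hq : ∀ u, q u ∈ stdSimplex ℝ V)
    (hw : ∀ v, w v ∈ stdSimplex ℝ Z) (m₁ : M₁) (a₂ : A₂) (b₂ : B₂) :
    ∑ C : A₂ × Ra → U × (M₁ × B₂ × Rb → V), bookWeight p q C *
      ∑ z, ((Fintype.card (Ra × Rb) : ℝ)⁻¹ *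
          ∑ r : Ra × Rb, w ((C (a₂, r.1)).2 (m₁, b₂, r.2)) z) *
        Real.log (((Fintype.card (Ra × Rb) : ℝ)⁻¹ *
          ∑ r : Ra × Rb, w ((C (a₂, r.1)).2 (m₁, b₂, r.2)) z) / out p q w z) ≤
    ∑ u, ∑ v, ∑ z, p u * q u v * w v z *
      Real.log (condMean p q (Fintype.card Ra) (Fintype.card Rb) (fun v => w v z) u v /
        (Fintype.card Ra * Fintype.card Rb * out p q w z)) := by
  set N : ℝ := Fintype.card Ra * Fintype.card Rb with hN
  have hNpos : 0 < N := by
    have h1 : 0 < Fintype.card Ra := Fintype.card_pos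
    have h2 : 0 < Fintype.card Rb := Fintype.card_pos
    positivity
  have hcard : (Fintype.card (Ra × Rb) : ℝ) = N := by rw [Fintype.card_prod, Nat.cast_mul]
  -- The codewords of a fixed message pair form a sub-codebook with free cloud index in Ra and free
  -- satellite index in Rb.
  let A' : Finset (A₂ × Ra) := {a₂} ×ˢ Finset.univ
  let B' : Finset (M₁ × B₂ × Rb) := {m₁} ×ˢ ({b₂} ×ˢ Finset.univ)
  have hA' : A'.card = Fintype.card Ra := by simp [A']
  have hB' : B'.card = Fintype.card Rb := by simp [B']
  have hsum : ∀ (C : A₂ × Ra → U × (M₁ × B₂ × Rb → V)) z,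
      ∑ r : Ra × Rb, w ((C (a₂, r.1)).2 (m₁, b₂, r.2)) z =
        ∑ a' ∈ A', ∑ b' ∈ B', w ((C a').2 b') z := fun C z => by
    simp [A', B', Fintype.sum_prod_type]
  have h1 : ∀ z (r : Ra × Rb), ∑ C : A₂ × Ra → U × (M₁ × B₂ × Rb → V), bookWeight p q C *
        (w ((C (a₂, r.1)).2 (m₁, b₂, r.2)) z *
          Real.log ((∑ a' ∈ A', ∑ b' ∈ B', w ((C a').2 b') z) / (N * out p q w z))) ≤
      ∑ u, ∑ v, p u * q u v * (w v z *
        Real.log (condMean p q (Fintype.card Ra) (Fintype.card Rb) (fun v => w v z) u v /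
          (N * out p q w z))) := fun z r => by
    rw [← hA', ← hB']
    exact sum_bookWeight_mul_log_le hp hq (a := (a₂, r.1)) (b := (m₁, b₂, r.2)) (by simp [A'])
      (by simp [B']) (fun v => w v z) (fun v => (hw v).1 z) (fun _ => N * out p q w z)
      fun u v hu hv hz => mul_pos hNpos (out_pos hp hq hw hu hv hz)
  have h2 : ∀ (C : A₂ × Ra → U × (M₁ × B₂ × Rb → V)), bookWeight p q C *
      ∑ z, (N⁻¹ * ∑ r : Ra × Rb, w ((C (a₂, r.1)).2 (m₁, b₂, r.2)) z) *
        Real.log ((N⁻¹ * ∑ r : Ra × Rb, w ((C (a₂, r.1)).2 (m₁, b₂, r.2)) z) / out p q w z) =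
      ∑ z, N⁻¹ * ∑ r : Ra × Rb, bookWeight p q C * (w ((C (a₂, r.1)).2 (m₁, b₂, r.2)) z *
          Real.log ((∑ a' ∈ A', ∑ b' ∈ B', w ((C a').2 b') z) / (N * out p q w z))) := fun C => by
    rw [Finset.mul_sum]
    refine Finset.sum_congr rfl fun z _ => ?_
    rw [← Finset.mul_sum, ← Finset.sum_mul, hsum, inv_mul_eq_div, div_div]
    ring
  rw [hcard]
  simp_rw [h2]
  rw [Finset.sum_comm]
  calc _ ≤ ∑ z, ∑ u, ∑ v, p u * q u v * (w v z *
        Real.log (condMean p q (Fintype.card Ra) (Fintype.card Rb) (fun v => w v z) u v /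
          (N * out p q w z))) := Finset.sum_le_sum fun z _ => by
        rw [← Finset.mul_sum, Finset.sum_comm, inv_mul_le_iff₀ hNpos]
        refine (Finset.sum_le_sum fun r _ => h1 z r).trans (le_of_eq ?_)
        rw [Finset.sum_const, nsmul_eq_mul, Finset.card_univ, hcard]
    _ = _ := by
        rw [Finset.sum_comm]
        refine Finset.sum_congr rfl fun u _ => ?_
        rw [Finset.sum_comm]
        simp_rw [mul_assoc]

/-- Mean divergence, over the random codebook, of the output given a strong message from the output
given the cloud centre only. -/
theorem sum_bookWeight_mul_strongDivergence_le [Nonempty A₂] [Nonempty Ra] [Nonempty B₂]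
    [Nonempty Rb] (hp : p ∈ stdSimplex ℝ U) (hq : ∀ u, q u ∈ stdSimplex ℝ V)
    (hw : ∀ v, w v ∈ stdSimplex ℝ Z) (m₁ : M₁) :
    ∑ C : A₂ × Ra → U × (M₁ × B₂ × Rb → V), bookWeight p q C *
      ∑ z, ((Fintype.card (A₂ × Ra) : ℝ)⁻¹ * ∑ a, (Fintype.card (B₂ × Rb) : ℝ)⁻¹ *
          ∑ b : B₂ × Rb, w ((C a).2 (m₁, b)) z) *
        Real.log (((Fintype.card (A₂ × Ra) : ℝ)⁻¹ * ∑ a, (Fintype.card (B₂ × Rb) : ℝ)⁻¹ *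
          ∑ b : B₂ × Rb, w ((C a).2 (m₁, b)) z) /
            ((Fintype.card (A₂ × Ra) : ℝ)⁻¹ * ∑ a, cloudOut q w (C a).1 z)) ≤
    ∑ u, ∑ v, ∑ z, p u * q u v * w v z *
      Real.log (condMean p q 1 (Fintype.card (B₂ × Rb)) (fun v => w v z) u v /
        (Fintype.card (B₂ × Rb) * cloudOut q w u z)) := by
  have hL : (0 : ℝ) < Fintype.card (A₂ × Ra) := by exact_mod_cast Fintype.card_pos
  have hK : (0 : ℝ) < Fintype.card (B₂ × Rb) := by exact_mod_cast Fintype.card_pos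
  set L : ℝ := (Fintype.card (A₂ × Ra) : ℝ) with hLdef
  set K : ℝ := (Fintype.card (B₂ × Rb) : ℝ) with hKdef
  let B' : Finset (M₁ × B₂ × Rb) := {m₁} ×ˢ Finset.univ
  have hB' : B'.card = Fintype.card (B₂ × Rb) := by simp [B']
  have hsum : ∀ (C : A₂ × Ra → U × (M₁ × B₂ × Rb → V)) a z,
      ∑ b : B₂ × Rb, w ((C a).2 (m₁, b)) z =
        ∑ a' ∈ {a}, ∑ b' ∈ B', w ((C a').2 b') z := fun C a z => by
    simp [B']
  have h1 : ∀ z a (b : B₂ × Rb), ∑ C : A₂ × Ra → U × (M₁ × B₂ × Rb → V), bookWeight p q C *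
        (w ((C a).2 (m₁, b)) z *
          Real.log ((∑ a' ∈ {a}, ∑ b' ∈ B', w ((C a').2 b') z) / (K * cloudOut q w (C a).1 z))) ≤
      ∑ u, ∑ v, p u * q u v * (w v z *
        Real.log (condMean p q 1 (Fintype.card (B₂ × Rb)) (fun v => w v z) u v /
          (K * cloudOut q w u z))) := fun z a b => by
    rw [← hB', ← Finset.card_singleton a]
    exact sum_bookWeight_mul_log_le hp hq (a := a) (b := (m₁, b)) (by simp)
      (by simp [B']) (fun v => w v z) (fun v => (hw v).1 z) (fun u => K * cloudOut q w u z)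
      fun u v hu hv hz => mul_pos hK (cloudOut_pos hq hw hv hz)
  have h2 : ∀ (C : A₂ × Ra → U × (M₁ × B₂ × Rb → V)), bookWeight p q C *
      ∑ z, (L⁻¹ * ∑ a, K⁻¹ * ∑ b : B₂ × Rb, w ((C a).2 (m₁, b)) z) *
        Real.log ((L⁻¹ * ∑ a, K⁻¹ * ∑ b : B₂ × Rb, w ((C a).2 (m₁, b)) z) /
            (L⁻¹ * ∑ a, cloudOut q w (C a).1 z)) ≤
      ∑ z, L⁻¹ * ∑ a, K⁻¹ * ∑ b : B₂ × Rb, bookWeight p q C * (w ((C a).2 (m₁, b)) z *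
          Real.log ((∑ a' ∈ {a}, ∑ b' ∈ B', w ((C a').2 b') z) /
            (K * cloudOut q w (C a).1 z))) := fun C => by
    -- Codebooks of weight zero are set aside: only for the others does the reference law dominate
    -- the output law.
    rcases eq_or_ne (bookWeight p q C) 0 with hC | hC
    · simp [hC]
    rw [Finset.mul_sum]
    refine Finset.sum_le_sum fun z _ => ?_
    rw [mul_div_mul_left _ _ (inv_pos.2 hL).ne', mul_assoc L⁻¹, mul_left_comm]
    refine mul_le_mul_of_nonneg_left ?_ (inv_pos.2 hL).le
    simp_rw [← Finset.mul_sum, ← Finset.sum_mul, mul_left_comm K⁻¹]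
    refine mul_le_mul_of_nonneg_left ?_ (bookWeight_nonneg hp hq C)
    -- Joint convexity of divergence: numerator and reference are mixtures over the same clouds, so
    -- each cloud can be compared with its own reference. This is what reduces the problem to a
    -- single cloud.
    have hlog := sum_mul_log_sum_div_sum_le Finset.univ
      (fun a => K⁻¹ * ∑ b : B₂ × Rb, w ((C a).2 (m₁, b)) z) (fun a => cloudOut q w (C a).1 z)
      (fun a _ => mul_nonneg (inv_pos.2 hK).le (Finset.sum_nonneg fun b _ => (hw _).1 z))
      (fun a _ => (cloudOut_mem_stdSimplex hq hw _).1 z) (fun a _ ha => by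
        obtain ⟨b, -, hb⟩ := Finset.exists_ne_zero_of_sum_ne_zero (right_ne_zero_of_mul ha.ne')
        exact cloudOut_pos hq hw (pos_of_bookWeight_ne_zero hp hq hC a (m₁, b)).2
          (((hw _).1 z).lt_of_ne' hb))
    rw [← Finset.mul_sum] at hlog
    refine hlog.trans (le_of_eq ?_)
    rw [Finset.mul_sum]
    refine Finset.sum_congr rfl fun a _ => ?_
    rw [hsum, inv_mul_eq_div, div_div]
    ring
  refine (Finset.sum_le_sum fun C _ => h2 C).trans ?_
  rw [Finset.sum_comm]
  calc _ ≤ ∑ z, ∑ u, ∑ v, p u * q u v * (w v z *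
        Real.log (condMean p q 1 (Fintype.card (B₂ × Rb)) (fun v => w v z) u v /
          (K * cloudOut q w u z))) := Finset.sum_le_sum fun z _ => by
        rw [← Finset.mul_sum, Finset.sum_comm, inv_mul_le_iff₀ hL, hLdef, ← Finset.card_univ,
          ← nsmul_eq_mul, ← Finset.sum_const]
        refine Finset.sum_le_sum fun a _ => ?_
        rw [← Finset.mul_sum, Finset.sum_comm, inv_mul_le_iff₀ hK, hKdef, ← Finset.card_univ,
          ← nsmul_eq_mul, ← Finset.sum_const]
        exact Finset.sum_le_sum fun b _ => h1 z a b
    _ = _ := by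
        rw [Finset.sum_comm]
        refine Finset.sum_congr rfl fun u _ => ?_
        rw [Finset.sum_comm]
        simp_rw [mul_assoc]

variable {A B : Type*} [Fintype A] [Fintype B] [DecidableEq A] [DecidableEq B]

/-- Mean error, over the random codebook, of the decoder that draws a codeword from its posterior
distribution. -/
theorem sum_bookWeight_mul_error_le [Nonempty A] [Nonempty B]
    (hp : p ∈ stdSimplex ℝ U) (hq : ∀ u, q u ∈ stdSimplex ℝ V) (hw : ∀ v, w v ∈ stdSimplex ℝ Z) :
    ∑ C : A → U × (B → V), bookWeight p q C *
      (1 - (Fintype.card (A × B) : ℝ)⁻¹ * ∑ x : A × B, ∑ z, w ((C x.1).2 x.2) z *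
        (w ((C x.1).2 x.2) z / ∑ a, ∑ b, w ((C a).2 b) z)) ≤
    ∑ u, ∑ v, ∑ z, p u * q u v * w v z *
      (1 - w v z / condMean p q (Fintype.card A) (Fintype.card B) (fun v => w v z) u v) := by
  have hL : (0 : ℝ) < Fintype.card (A × B) := by exact_mod_cast Fintype.card_pos
  simp_rw [mul_sub, mul_one, Finset.sum_sub_distrib]
  rw [sum_bookWeight hp hq, chain_sum_one hp hq hw, sub_le_sub_iff_left]
  simp_rw [mul_left_comm (bookWeight p q _), ← Finset.mul_sum]
  rw [le_inv_mul_iff₀ hL, ← Finset.card_univ, ← nsmul_eq_mul, ← Finset.sum_const]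
  simp_rw [Finset.mul_sum]
  rw [Finset.sum_comm (s := Finset.univ (α := A → U × (B → V)))]
  refine Finset.sum_le_sum fun x _ => ?_
  rw [Finset.sum_comm (s := Finset.univ (α := A → U × (B → V)))]
  calc _ = ∑ z, ∑ u, ∑ v, p u * q u v * (w v z * (w v z /
          condMean p q (Fintype.card A) (Fintype.card B) (fun v => w v z) u v)) := by
        rw [Finset.sum_comm (s := Finset.univ (α := Z))]
        refine Finset.sum_congr rfl fun u _ => ?_
        rw [Finset.sum_comm]
        simp_rw [mul_assoc]
    _ ≤ _ := Finset.sum_le_sum fun z _ => le_sum_bookWeight_mul_div hp hq x.1 x.2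
        (fun v => w v z) fun v => (hw v).1 z

end OneShot

/-! ### Error and leakage of a concrete code -/

section CodeLaw

variable {𝒳 𝒪 𝒵 : Type*} {n : ℕ}

theorem piPMF_map [Fintype 𝒪] [Fintype 𝒵] (P : Fin n → PMF 𝒪) (g : 𝒪 → 𝒵) :
    (piPMF P).map (fun o i => g (o i)) = piPMF fun i => (P i).map g := by
  classical
  ext z
  simp only [PMF.map_apply, piPMF, PMF.ofFintype_apply, tsum_fintype]
  rw [← sum_pi_prod fun i a => if z i = g a then P i a else 0]
  refine Finset.sum_congr rfl fun o _ => ?_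
  split_ifs with h
  · exact Finset.prod_congr rfl fun i _ => by rw [if_pos (congrFun h i)]
  · obtain ⟨i, hi⟩ := Function.ne_iff.1 h
    exact (Finset.prod_eq_zero (Finset.mem_univ i) (if_neg hi)).symm

theorem piPMF_bind [Fintype 𝒳] [Fintype 𝒪] (κ : Fin n → PMF 𝒳) (W : 𝒳 → PMF 𝒪) :
    ((piPMF κ).bind fun x => piPMF fun i => W (x i)) = piPMF fun i => (κ i).bind W := by
  ext z
  simp only [PMF.bind_apply, piPMF, PMF.ofFintype_apply, tsum_fintype, ← Finset.prod_mul_distrib]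
  exact sum_pi_prod fun i x => κ i x * W x (z i)

theorem jointLaw_apply {α : Type*} [Fintype α] (p : PMF α) (X : α → 𝒳) (W : 𝒳 → PMF 𝒪) (a : α)
    (o : 𝒪) : jointLaw p X W (a, o) = p a * W (X a) o := by
  classical
  rw [jointLaw, PMF.bind_apply, tsum_fintype, Finset.sum_eq_single a]
  · rw [PMF.map_apply, tsum_eq_single o]
    · simp
    · intro o' ho'
      simp [ho'.symm]
  · intro a' _ ha'
    rw [PMF.map_apply]
    simp [ha'.symm]
  · simp

theorem jointLaw_map {α : Type*} (p : PMF α) (X : α → 𝒳) (W : 𝒳 → PMF 𝒪) (g : 𝒪 → 𝒵) :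
    (jointLaw p X W).map (fun ω => (ω.1, g ω.2)) = jointLaw p X fun x => (W x).map g := by
  simp [jointLaw, PMF.map_bind, PMF.map_comp, Function.comp_def]

variable {𝒱 : Type*}

/-- Transition probabilities from `𝒱` to the component `g` of the channel output. -/
noncomputable def outKernel (κ : 𝒱 → PMF 𝒳) (W : 𝒳 → PMF 𝒪) (g : 𝒪 → 𝒵) (v : 𝒱) (z : 𝒵) : ℝ :=
  ((((κ v).bind W).map g) z).toReal

theorem outKernel_mem_stdSimplex [Fintype 𝒵] (κ : 𝒱 → PMF 𝒳) (W : 𝒳 → PMF 𝒪) (g : 𝒪 → 𝒵) (v : 𝒱) :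
    outKernel κ W g v ∈ stdSimplex ℝ 𝒵 :=
  toReal_mem_stdSimplex _

variable {𝒴 𝒵₁ 𝒵₂ R : Type*} [Fintype 𝒳] [Fintype 𝒴] [Fintype 𝒵₁] [Fintype 𝒵₂] [Fintype 𝒵]
  [Fintype R] [Nonempty R] {M₁ M₂ : ℕ+}

/-- The code that sends, for the message `m` and a uniform index `r`, the codeword `φ m r` through
the memoryless channel `κ`. -/
noncomputable def codeOf (κ : 𝒱 → PMF 𝒳) (φ : Fin M₁ × Fin M₂ → R → Fin n → 𝒱)
    (dec : (Fin n → 𝒴) → Fin M₁ × Fin M₂) : Code 𝒳 𝒴 M₁ M₂ n where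
  enc m := (PMF.uniformOfFintype R).bind fun r => piPMF fun i => κ (φ m r i)
  dec := dec

variable (κ : 𝒱 → PMF 𝒳) (W : Channel 𝒳 𝒴 𝒵₁ 𝒵₂) (φ : Fin M₁ × Fin M₂ → R → Fin n → 𝒱)
  (dec : (Fin n → 𝒴) → Fin M₁ × Fin M₂)

/-- Law of the output `z` given the message `m` for the codewords `φ`. -/
noncomputable def messageOut (w : 𝒱 → 𝒵 → ℝ) (φ : Fin M₁ × Fin M₂ → R → Fin n → 𝒱)
    (m : Fin M₁ × Fin M₂) (z : Fin n → 𝒵) : ℝ :=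
  (Fintype.card R : ℝ)⁻¹ * ∑ r, blockKernel n w (φ m r) z

theorem average_mem_stdSimplex {ι α : Type*} [Fintype ι] [Nonempty ι] [Fintype α] {f : ι → α → ℝ}
    (hf : ∀ i, f i ∈ stdSimplex ℝ α) :
    (fun a => (Fintype.card ι : ℝ)⁻¹ * ∑ i, f i a) ∈ stdSimplex ℝ α := by
  refine ⟨fun a => mul_nonneg (by positivity) (Finset.sum_nonneg fun i _ => (hf i).1 a), ?_⟩
  rw [← Finset.mul_sum, Finset.sum_comm]
  simp [(hf _).2]

theorem messageOut_mem_stdSimplex {w : 𝒱 → 𝒵 → ℝ} (hw : ∀ v, w v ∈ stdSimplex ℝ 𝒵)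
    (m : Fin M₁ × Fin M₂) : messageOut w φ m ∈ stdSimplex ℝ (Fin n → 𝒵) :=
  average_mem_stdSimplex fun r => blockKernel_mem_stdSimplex hw (φ m r)

/-- The prefix channel, the channel and the projection g all act letter by letter, so together they
form one memoryless kernel. Error and both leakages are read off from this formula with three
choices of g. -/
theorem codeOf_law_map_apply (g : 𝒴 × 𝒵₁ × 𝒵₂ → 𝒵) (m : Fin M₁ × Fin M₂) (z : Fin n → 𝒵) :
    ((((codeOf κ φ dec).law W).map fun ω => (ω.1, fun i => g (ω.2 i))) (m, z)).toReal =
      (Fintype.card (Fin M₁ × Fin M₂) : ℝ)⁻¹ * messageOut (outKernel κ W g) φ m z := by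
  have h : (((codeOf κ φ dec).law W).map fun ω => (ω.1, fun i => g (ω.2 i))) =
      jointLaw (PMF.uniformOfFintype (Fin M₁ × Fin M₂)) id fun m =>
        (PMF.uniformOfFintype R).bind fun r => piPMF fun i => ((κ (φ m r i)).bind W).map g := by
    rw [Code.law, jointLaw_map _ _ _ fun o : Fin n → 𝒴 × 𝒵₁ × 𝒵₂ => fun i => g (o i)]
    congr 1
    funext m
    rw [codeOf, PMF.bind_bind, PMF.map_bind]
    congr 1
    funext r
    rw [piPMF_bind, piPMF_map]
  rw [h, jointLaw_apply, ENNReal.toReal_mul, PMF.bind_apply, tsum_fintype, ENNReal.toReal_sum]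
  · simp [piPMF, messageOut, blockKernel, outKernel, ENNReal.toReal_prod, Finset.mul_sum]
  · intro r _
    exact ENNReal.mul_ne_top (PMF.apply_ne_top _ _) (PMF.apply_ne_top _ _)

theorem leakWeak_codeOf_le (Q : (Fin n → 𝒵₂) → ℝ) (hQ : Q ∈ stdSimplex ℝ (Fin n → 𝒵₂))
    (hφQ : ∀ m r z, 0 < blockKernel n (outKernel κ W fun o => o.2.2) (φ m r) z → 0 < Q z) :
    (codeOf κ φ dec).leakWeak W ≤ ((Fintype.card (Fin M₁ × Fin M₂) : ℝ)⁻¹ * ∑ m, ∑ z,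
      messageOut (outKernel κ W fun o => o.2.2) φ m z *
        Real.log (messageOut (outKernel κ W fun o => o.2.2) φ m z / Q z)) / Real.log 2 := by
  have h : (codeOf κ φ dec).leakWeak W = mutualInfo
      (((codeOf κ φ dec).law W).map fun ω => (ω.1, fun i => (ω.2 i).2.2)) Prod.fst Prod.snd := by
    rw [mutualInfo_map]; rfl
  rw [h]
  refine mutualInfo_le_divergence _ _
    (messageOut_mem_stdSimplex φ (outKernel_mem_stdSimplex κ W fun o => o.2.2))
    (codeOf_law_map_apply κ W φ dec fun o => o.2.2) Q hQ fun m z hz => ?_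
  obtain ⟨r, -, hr⟩ := Finset.exists_ne_zero_of_sum_ne_zero (right_ne_zero_of_mul hz.ne')
  exact hφQ m r z (((blockKernel_mem_stdSimplex
    (outKernel_mem_stdSimplex κ W fun o => o.2.2) _).1 _).lt_of_ne' hr)

/-- Averaging over m₂ turns M₂ into part of the randomness that hides M₁. Q is left free because the
useful reference depends on the codebook through its cloud centres. -/
theorem leakStrong_codeOf_le (Q : (Fin n → 𝒵₁) → ℝ) (hQ : Q ∈ stdSimplex ℝ (Fin n → 𝒵₁))
    (hφQ : ∀ m r z, 0 < blockKernel n (outKernel κ W fun o => o.2.1) (φ m r) z → 0 < Q z)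
    (T : Fin M₁ → (Fin n → 𝒵₁) → ℝ) (hT : ∀ m₁ z, T m₁ z = (Fintype.card (Fin M₂) : ℝ)⁻¹ *
      ∑ m₂, messageOut (outKernel κ W fun o => o.2.1) φ (m₁, m₂) z) :
    (codeOf κ φ dec).leakStrong W ≤ ((Fintype.card (Fin M₁) : ℝ)⁻¹ * ∑ m₁, ∑ z,
      T m₁ z * Real.log (T m₁ z / Q z)) / Real.log 2 := by
  set P := ((codeOf κ φ dec).law W).map fun ω => (ω.1, fun i => (ω.2 i).2.1) with hP
  have h : (codeOf κ φ dec).leakStrong W = mutualInfo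
      (P.map fun ω => (ω.1.1, ω.2)) Prod.fst Prod.snd := by
    rw [hP, PMF.map_comp, mutualInfo_map]; rfl
  have hw := outKernel_mem_stdSimplex κ W fun o => o.2.1
  have hT' : T = fun m₁ z => (Fintype.card (Fin M₂) : ℝ)⁻¹ *
      ∑ m₂, messageOut (outKernel κ W fun o => o.2.1) φ (m₁, m₂) z := by
    funext m₁ z; exact hT m₁ z
  rw [h]
  refine mutualInfo_le_divergence _ T (fun m₁ => ?_) (fun m₁ z => ?_) Q hQ fun m₁ z hz => ?_
  · rw [hT']
    exact average_mem_stdSimplex fun m₂ => messageOut_mem_stdSimplex φ hw (m₁, m₂)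
  · classical
    have : ∀ m z, (P (m, z)).toReal = _ := codeOf_law_map_apply κ W φ dec fun o => o.2.1
    rw [toReal_map_apply, hT, Fintype.sum_prod_type, Fintype.sum_prod_type,
      Finset.sum_eq_single m₁]
    · simp [this, Finset.mul_sum, mul_assoc, mul_comm]
    · intro m' _ hm'
      simp [hm']
    · simp
  · rw [hT] at hz
    obtain ⟨m₂, -, hm₂⟩ := Finset.exists_ne_zero_of_sum_ne_zero (right_ne_zero_of_mul hz.ne')
    obtain ⟨r, -, hr⟩ := Finset.exists_ne_zero_of_sum_ne_zero (right_ne_zero_of_mul hm₂)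
    exact hφQ _ r z (((blockKernel_mem_stdSimplex hw _).1 _).lt_of_ne' hr)

theorem errorProb_codeOf :
    (codeOf κ φ dec).errorProb W = 1 - ∑ y, (Fintype.card (Fin M₁ × Fin M₂) : ℝ)⁻¹ *
      messageOut (outKernel κ W fun o => o.1) φ (dec y) y := by
  classical
  set P := ((codeOf κ φ dec).law W).map fun ω => (ω.1, fun i => (ω.2 i).1) with hP
  have hPapply : ∀ m z, (P (m, z)).toReal = _ := codeOf_law_map_apply κ W φ dec fun o => o.1
  have h : (codeOf κ φ dec).errorProb W = (P.toOuterMeasure {t | dec t.2 ≠ t.1}).toReal := by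
    rw [hP, PMF.toOuterMeasure_map_apply]; rfl
  have e : ∑ y, (Fintype.card (Fin M₁ × Fin M₂) : ℝ)⁻¹ *
      messageOut (outKernel κ W fun o => o.1) φ (dec y) y =
      ∑ t, if dec t.2 = t.1 then (P t).toReal else 0 := by
    simp_rw [← hPapply]
    rw [Fintype.sum_prod_type_right]
    simp
  rw [h, PMF.toOuterMeasure_apply_fintype, ENNReal.toReal_sum, e, ← sum_toReal P,
    ← Finset.sum_sub_distrib]
  · refine Finset.sum_congr rfl fun t _ => ?_
    by_cases ht : dec t.2 = t.1 <;> simp [ht]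
  · intro t _
    by_cases ht : dec t.2 = t.1 <;> simp [ht, PMF.apply_ne_top]

/-- The maximum likelihood decoder errs at most as often as sampling from the posterior. -/
theorem exists_decoder :
    ∃ dec : (Fin n → 𝒴) → Fin M₁ × Fin M₂, (codeOf κ φ dec).errorProb W ≤
      1 - (Fintype.card ((Fin M₁ × Fin M₂) × R) : ℝ)⁻¹ * ∑ x : (Fin M₁ × Fin M₂) × R, ∑ y,
        blockKernel n (outKernel κ W fun o => o.1) (φ x.1 x.2) y *
          (blockKernel n (outKernel κ W fun o => o.1) (φ x.1 x.2) y /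
            ∑ x' : (Fin M₁ × Fin M₂) × R,
              blockKernel n (outKernel κ W fun o => o.1) (φ x'.1 x'.2) y) := by
  set w := outKernel κ W fun o => o.1
  have hw0 : ∀ v y, 0 ≤ blockKernel n w v y := fun v y =>
    (blockKernel_mem_stdSimplex (outKernel_mem_stdSimplex κ W fun o => o.1) v).1 y
  have hex : ∀ y : Fin n → 𝒴, ∃ x : (Fin M₁ × Fin M₂) × R, ∀ x' : (Fin M₁ × Fin M₂) × R,
      blockKernel n w (φ x'.1 x'.2) y ≤ blockKernel n w (φ x.1 x.2) y := fun y => by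
    obtain ⟨x, -, hx⟩ := Finset.exists_max_image Finset.univ
      (fun x : (Fin M₁ × Fin M₂) × R => blockKernel n w (φ x.1 x.2) y) Finset.univ_nonempty
    exact ⟨x, fun x' => hx x' (Finset.mem_univ _)⟩
  choose d hd using hex
  refine ⟨fun y => (d y).1, ?_⟩
  rw [errorProb_codeOf, sub_le_sub_iff_left, Finset.sum_comm, Finset.mul_sum]
  refine Finset.sum_le_sum fun y _ => ?_
  rw [Fintype.card_prod (Fin M₁ × Fin M₂) R, Nat.cast_mul, mul_inv, messageOut, mul_assoc]
  refine mul_le_mul_of_nonneg_left (mul_le_mul_of_nonneg_left ?_ (by positivity)) (by positivity)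
  -- The largest likelihood dominates the average of likelihoods under the posterior weights. These
  -- sum to at most one, and to zero if every likelihood vanishes.
  calc _ ≤ ∑ x : (Fin M₁ × Fin M₂) × R, blockKernel n w (φ (d y).1 (d y).2) y *
          (blockKernel n w (φ x.1 x.2) y /
            ∑ x' : (Fin M₁ × Fin M₂) × R, blockKernel n w (φ x'.1 x'.2) y) :=
        Finset.sum_le_sum fun x _ => mul_le_mul_of_nonneg_right (hd y x)
          (div_nonneg (hw0 _ _) (Finset.sum_nonneg fun _ _ => hw0 _ _))
    _ ≤ blockKernel n w (φ (d y).1 (d y).2) y := by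
        rw [← Finset.mul_sum, ← Finset.sum_div]
        exact mul_le_of_le_one_right (hw0 _ _) (div_self_le_one _)
    _ ≤ _ := Finset.single_le_sum (f := fun r => blockKernel n w (φ (d y).1 r) y)
        (fun _ _ => hw0 _ _) (Finset.mem_univ _)

end CodeLaw

/-! ### Selecting a codebook -/

section RandomCoding

variable {𝒳 𝒴 𝒵₁ 𝒵₂ 𝒰 𝒱 : Type*} [Fintype 𝒳] [Fintype 𝒴] [Fintype 𝒵₁] [Fintype 𝒵₂]
  [Fintype 𝒰] [Fintype 𝒱] {n : ℕ}

/-- The codeword of a superposition codebook for the message `m` and the random index `r`. -/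
def bookWord {U V : Type*} {M₁ A₂ B₂ Ra Rb : ℕ+}
    (C : Fin A₂ × Fin Ra → U × (Fin M₁ × Fin B₂ × Fin Rb → V))
    (m : Fin M₁ × Fin (A₂ * B₂ : ℕ+)) (r : Fin Ra × Fin Rb) : V :=
  (C ((finProdFinEquiv.symm m.2).1, r.1)).2 (m.1, (finProdFinEquiv.symm m.2).2, r.2)

/-- The index of the codeword for the message `m` and the random index `r`. -/
def bookIndex (M₁ A₂ B₂ Ra Rb : ℕ+) :
    (Fin M₁ × Fin (A₂ * B₂ : ℕ+)) × (Fin Ra × Fin Rb) ≃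
      (Fin A₂ × Fin Ra) × (Fin M₁ × Fin B₂ × Fin Rb) where
  toFun x := (((finProdFinEquiv.symm x.1.2).1, x.2.1),
    (x.1.1, (finProdFinEquiv.symm x.1.2).2, x.2.2))
  invFun y := ((y.2.1, finProdFinEquiv (y.1.1, y.2.2.1)), (y.1.2, y.2.2.2))
  left_inv _ := Prod.ext (Prod.ext rfl (finProdFinEquiv.apply_symm_apply _)) rfl
  right_inv y := by simp

theorem sum_mul_average_le {ι μ : Type*} [Fintype ι] [Fintype μ] [Nonempty μ] (a : ι → ℝ)
    (F : ι → μ → ℝ) {ε : ℝ} (h : ∀ m, ∑ i, a i * F i m ≤ ε) :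
    ∑ i, a i * ((Fintype.card μ : ℝ)⁻¹ * ∑ m, F i m) ≤ ε := by
  simp_rw [mul_left_comm (a _), ← Finset.mul_sum]
  rw [inv_mul_le_iff₀ (by exact_mod_cast Fintype.card_pos)]
  simp_rw [Finset.mul_sum]
  rw [Finset.sum_comm, ← Finset.card_univ, ← nsmul_eq_mul, ← Finset.sum_const]
  exact Finset.sum_le_sum fun m _ => h m

/-- Some codebook has error and leakage not above the mean over the random codebook. -/
theorem exists_code_le_mean (W : Channel 𝒳 𝒴 𝒵₁ 𝒵₂) (κ : 𝒱 → PMF 𝒳) {p : 𝒰 → ℝ} {q : 𝒰 → 𝒱 → ℝ}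
    (hp : p ∈ stdSimplex ℝ 𝒰) (hq : ∀ u, q u ∈ stdSimplex ℝ 𝒱) (M₁ A₂ B₂ Ra Rb : ℕ+)
    {t : ℝ} (ht : 0 ≤ t) {εe εw εs : ℝ}
    (he : ∑ u, ∑ v, ∑ z, blockLaw n p u * blockKernel n q u v *
        blockKernel n (outKernel κ W fun o => o.1) v z *
        (1 - blockKernel n (outKernel κ W fun o => o.1) v z /
          condMean (blockLaw n p) (blockKernel n q) (A₂ * Ra : ℕ+) (M₁ * (B₂ * Rb) : ℕ+)
            (fun v => blockKernel n (outKernel κ W fun o => o.1) v z) u v) ≤ εe)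
    (hw : ∑ u, ∑ v, ∑ z, blockLaw n p u * blockKernel n q u v *
        blockKernel n (outKernel κ W fun o => o.2.2) v z *
        Real.log (condMean (blockLaw n p) (blockKernel n q) Ra Rb
          (fun v => blockKernel n (outKernel κ W fun o => o.2.2) v z) u v /
          ((Ra : ℕ) * (Rb : ℕ) * out (blockLaw n p) (blockKernel n q)
            (blockKernel n (outKernel κ W fun o => o.2.2)) z)) ≤ εw)
    (hs : ∑ u, ∑ v, ∑ z, blockLaw n p u * blockKernel n q u v *
        blockKernel n (outKernel κ W fun o => o.2.1) v z *
        Real.log (condMean (blockLaw n p) (blockKernel n q) 1 (B₂ * Rb : ℕ+)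
          (fun v => blockKernel n (outKernel κ W fun o => o.2.1) v z) u v /
          ((B₂ * Rb : ℕ+) * cloudOut (blockKernel n q)
            (blockKernel n (outKernel κ W fun o => o.2.1)) u z)) ≤ εs) :
    ∃ c : Code 𝒳 𝒴 M₁ (A₂ * B₂) n,
      c.errorProb W + t * (c.leakWeak W * Real.log 2) + t * (c.leakStrong W * Real.log 2) ≤
        εe + t * εw + t * εs := by
  have hl : 0 < Real.log 2 := Real.log_pos one_lt_two
  have hp' := blockLaw_mem_stdSimplex (n := n) hp
  have hq' := blockKernel_mem_stdSimplex (n := n) hq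
  have hY := blockKernel_mem_stdSimplex (n := n) (outKernel_mem_stdSimplex κ W fun o => o.1)
  have hZ₁ := blockKernel_mem_stdSimplex (n := n) (outKernel_mem_stdSimplex κ W fun o => o.2.1)
  have hZ₂ := blockKernel_mem_stdSimplex (n := n) (outKernel_mem_stdSimplex κ W fun o => o.2.2)
  choose dec hdec using fun C : Fin A₂ × Fin Ra →
      (Fin n → 𝒰) × (Fin M₁ × Fin B₂ × Fin Rb → Fin n → 𝒱) => exists_decoder κ W (bookWord C)
  let c := fun C : Fin A₂ × Fin Ra → (Fin n → 𝒰) × (Fin M₁ × Fin B₂ × Fin Rb → Fin n → 𝒱) =>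
    codeOf κ (bookWord C) (dec C)
  have E : ∑ C, bookWeight (blockLaw n p) (blockKernel n q) C * (c C).errorProb W ≤ εe := by
    refine le_trans ?_ ((sum_bookWeight_mul_error_le (A := Fin A₂ × Fin Ra)
      (B := Fin M₁ × Fin B₂ × Fin Rb) hp' hq' hY).trans (by simpa using he))
    refine Finset.sum_le_sum fun C _ =>
      mul_le_mul_of_nonneg_left ((hdec C).trans (le_of_eq ?_)) (bookWeight_nonneg hp' hq' C)
    rw [Fintype.card_congr (bookIndex M₁ A₂ B₂ Ra Rb)]
    congr 2
    refine Fintype.sum_equiv (bookIndex M₁ A₂ B₂ Ra Rb) _ _ fun x =>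
      Finset.sum_congr rfl fun y _ => ?_
    have : ∑ x' : (Fin M₁ × Fin (A₂ * B₂ : ℕ+)) × (Fin Ra × Fin Rb),
        blockKernel n (outKernel κ W fun o => o.1) (bookWord C x'.1 x'.2) y =
        ∑ a, ∑ b, blockKernel n (outKernel κ W fun o => o.1) ((C a).2 b) y := by
      rw [← Fintype.sum_prod_type' (f := fun a b =>
        blockKernel n (outKernel κ W fun o => o.1) ((C a).2 b) y)]
      exact Fintype.sum_equiv (bookIndex M₁ A₂ B₂ Ra Rb) _ _ fun x => rfl
    rw [this]
    rfl
  have Wk : ∑ C, bookWeight (blockLaw n p) (blockKernel n q) C *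
      ((c C).leakWeak W * Real.log 2) ≤ εw := by
    have key : ∀ C, bookWeight (blockLaw n p) (blockKernel n q) C *
        ((c C).leakWeak W * Real.log 2) ≤
        bookWeight (blockLaw n p) (blockKernel n q) C *
        ((Fintype.card (Fin M₁ × Fin (A₂ * B₂ : ℕ+)) : ℝ)⁻¹ * ∑ m, ∑ z,
      messageOut (outKernel κ W fun o => o.2.2) (bookWord C) m z *
        Real.log (messageOut (outKernel κ W fun o => o.2.2) (bookWord C) m z /
          out (blockLaw n p) (blockKernel n q)
            (blockKernel n (outKernel κ W fun o => o.2.2)) z)) := fun C => by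
      rcases eq_or_ne (bookWeight (blockLaw n p) (blockKernel n q) C) 0 with h0 | h0
      · simp [h0]
      refine mul_le_mul_of_nonneg_left ?_ (bookWeight_nonneg hp' hq' C)
      rw [← le_div_iff₀ hl]
      refine leakWeak_codeOf_le κ W (bookWord C) (dec C) _ (out_mem_stdSimplex hp' hq' hZ₂)
        fun m r z hz => ?_
      have := pos_of_bookWeight_ne_zero hp' hq' h0 ((finProdFinEquiv.symm m.2).1, r.1)
        (m.1, (finProdFinEquiv.symm m.2).2, r.2)
      exact out_pos hp' hq' hZ₂ this.1 this.2 hz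
    refine (Finset.sum_le_sum fun C _ => key C).trans ?_
    refine sum_mul_average_le _ _ fun m => ?_
    refine (sum_bookWeight_mul_weakDivergence_le hp' hq' hZ₂ m.1 (finProdFinEquiv.symm m.2).1
      (finProdFinEquiv.symm m.2).2).trans ?_
    simpa using hw
  have St : ∑ C, bookWeight (blockLaw n p) (blockKernel n q) C *
      ((c C).leakStrong W * Real.log 2) ≤ εs := by
    have key : ∀ C, bookWeight (blockLaw n p) (blockKernel n q) C *
        ((c C).leakStrong W * Real.log 2) ≤
        bookWeight (blockLaw n p) (blockKernel n q) C *
        ((Fintype.card (Fin M₁) : ℝ)⁻¹ * ∑ m₁, ∑ z,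
          ((Fintype.card (Fin A₂ × Fin Ra) : ℝ)⁻¹ *
            ∑ a, (Fintype.card (Fin B₂ × Fin Rb) : ℝ)⁻¹ * ∑ b : Fin B₂ × Fin Rb,
              blockKernel n (outKernel κ W fun o => o.2.1) ((C a).2 (m₁, b)) z) *
          Real.log (((Fintype.card (Fin A₂ × Fin Ra) : ℝ)⁻¹ *
            ∑ a, (Fintype.card (Fin B₂ × Fin Rb) : ℝ)⁻¹ * ∑ b : Fin B₂ × Fin Rb,
              blockKernel n (outKernel κ W fun o => o.2.1) ((C a).2 (m₁, b)) z) /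
            ((Fintype.card (Fin A₂ × Fin Ra) : ℝ)⁻¹ * ∑ a, cloudOut (blockKernel n q)
            (blockKernel n (outKernel κ W fun o => o.2.1)) (C a).1 z))) := fun C => by
      rcases eq_or_ne (bookWeight (blockLaw n p) (blockKernel n q) C) 0 with h0 | h0
      · simp [h0]
      refine mul_le_mul_of_nonneg_left ?_ (bookWeight_nonneg hp' hq' C)
      rw [← le_div_iff₀ hl]
      refine leakStrong_codeOf_le κ W (bookWord C) (dec C) _
        (average_mem_stdSimplex fun a => cloudOut_mem_stdSimplex hq' hZ₁ (C a).1)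
        (fun m r z hz => ?_) _ fun m₁ z => ?_
      · have := pos_of_bookWeight_ne_zero hp' hq' h0 ((finProdFinEquiv.symm m.2).1, r.1)
          (m.1, (finProdFinEquiv.symm m.2).2, r.2)
        have h1 := cloudOut_pos hq' hZ₁ this.2 hz
        refine mul_pos (by simp) (h1.trans_le
          (Finset.single_le_sum (f := fun a => cloudOut (blockKernel n q)
            (blockKernel n (outKernel κ W fun o => o.2.1)) (C a).1 z)
            (fun a _ => (cloudOut_mem_stdSimplex hq' hZ₁ _).1 z) (Finset.mem_univ _)))
      -- Splitting m₂ into its cloud part and its satellite part turns the average over m₂ and the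
      -- dummy indices into an average over all clouds and, in each, over the satellites compatible
      -- with m₁.
      · have e := Fintype.sum_equiv (finProdFinEquiv (m := A₂) (n := B₂)).symm
          (fun m₂ : Fin (A₂ * B₂ : ℕ+) =>
            messageOut (outKernel κ W fun o => o.2.1) (bookWord C) (m₁, m₂) z)
          (fun x => (Fintype.card (Fin Ra × Fin Rb) : ℝ)⁻¹ * ∑ r : Fin Ra × Fin Rb,
            blockKernel n (outKernel κ W fun o => o.2.1) ((C (x.1, r.1)).2 (m₁, x.2, r.2)) z)
          fun m₂ => rfl
        have hc : (Fintype.card (Fin (A₂ * B₂ : ℕ+)) : ℝ) = (A₂ : ℕ) * (B₂ : ℕ) := by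
          rw [Fintype.card_fin, PNat.mul_coe, Nat.cast_mul]
        rw [hc]
        refine Eq.trans ?_ (congrArg (fun s => ((A₂ : ℕ) * (B₂ : ℕ) : ℝ)⁻¹ * s) e.symm)
        simp_rw [← Finset.mul_sum, ← mul_assoc]
        congr 1
        · simp only [Fintype.card_prod, Fintype.card_fin, Nat.cast_mul, mul_inv]
          ring
        · simp_rw [Fintype.sum_prod_type]
          refine Finset.sum_congr rfl fun a _ => ?_
          rw [Finset.sum_comm]
    refine (Finset.sum_le_sum fun C _ => key C).trans ?_
    refine sum_mul_average_le _ _ fun m₁ => ?_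
    refine (sum_bookWeight_mul_strongDivergence_le hp' hq' hZ₁ m₁).trans ?_
    simpa using hs
  -- The three averages must be met by one codebook, hence the comparison of a single weighted sum.
  -- Strictness needs a codebook of positive weight, which exists since the weights total one.
  by_contra! hcon
  have h1 : ∑ C, bookWeight (blockLaw n p) (blockKernel n q) C *
      ((c C).errorProb W + t * ((c C).leakWeak W * Real.log 2) +
        t * ((c C).leakStrong W * Real.log 2)) ≤ εe + t * εw + t * εs := by
    simp_rw [mul_add, Finset.sum_add_distrib, mul_left_comm _ t, ← Finset.mul_sum]
    gcongr
  have h2 : ∑ C : Fin A₂ × Fin Ra → (Fin n → 𝒰) × (Fin M₁ × Fin B₂ × Fin Rb → Fin n → 𝒱),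
      bookWeight (blockLaw n p) (blockKernel n q) C * (εe + t * εw + t * εs) =
        εe + t * εw + t * εs := by
    rw [← Finset.sum_mul, sum_bookWeight hp' hq', one_mul]
  have h3 : ∃ C : Fin A₂ × Fin Ra → (Fin n → 𝒰) × (Fin M₁ × Fin B₂ × Fin Rb → Fin n → 𝒱),
      bookWeight (blockLaw n p) (blockKernel n q) C ≠ 0 := by
    by_contra! h0
    have := sum_bookWeight (A := Fin A₂ × Fin Ra) (B := Fin M₁ × Fin B₂ × Fin Rb) hp' hq'
    simp [h0] at this
  obtain ⟨C₀, hC₀⟩ := h3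
  have h4 := Finset.sum_lt_sum
    (fun C _ => mul_le_mul_of_nonneg_left (hcon (c C)).le (bookWeight_nonneg hp' hq' C))
    ⟨C₀, Finset.mem_univ _, mul_lt_mul_of_pos_left (hcon (c C₀))
      ((bookWeight_nonneg hp' hq' C₀).lt_of_ne' hC₀)⟩
  linarith

end RandomCoding

/-! ### Integer code sizes and the rate back-off -/

section Rates

/-- The number of messages of rate `r - δ` (in nats) and block length `n`, at least one. -/
noncomputable def blockSize (r δ : ℝ) (n : ℕ) : ℕ+ :=
  ⟨max 1 ⌊Real.exp (n * (r - δ))⌋₊, by positivity⟩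

/-- Either there is a single message or the rate is at most `r - δ`. -/
def IsRateBound (n : ℕ) (δ r : ℝ) (N : ℕ+) : Prop :=
  N = 1 ∨ ((N : ℕ) : ℝ) ≤ Real.exp (n * (r - δ))

variable {n : ℕ} {δ r r' : ℝ} {N N' : ℕ+}

theorem isRateBound_blockSize : IsRateBound n δ r (blockSize r δ n) := by
  rcases le_total 1 ⌊Real.exp (n * (r - δ))⌋₊ with h | h
  · right
    simp only [blockSize, PNat.mk_coe, max_eq_right h]
    exact Nat.floor_le (Real.exp_pos _).le
  · left
    apply PNat.eq
    simp [blockSize, max_eq_left h]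

theorem IsRateBound.le (h : IsRateBound n δ r N) (hδ : 0 ≤ δ) (hr : 0 ≤ r) :
    ((N : ℕ) : ℝ) ≤ Real.exp (n * r) := by
  rcases h with h | h
  · rw [h]
    simpa using mul_nonneg (Nat.cast_nonneg n) hr
  · refine h.trans (Real.exp_le_exp.2 ?_)
    gcongr
    linarith

theorem IsRateBound.sub_one_le (h : IsRateBound n δ r N) :
    ((N : ℕ) : ℝ) - 1 ≤ Real.exp (n * (r - δ)) := by
  rcases h with h | h
  · rw [h]
    simpa using (Real.exp_pos _).le
  · linarith

/-- One back-off δ suffices for the product: a single factor has to pay it, unless both factors are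
trivial. -/
theorem IsRateBound.mul (h : IsRateBound n δ r N) (h' : IsRateBound n δ r' N') (hδ : 0 ≤ δ)
    (hr : 0 ≤ r) (hr' : 0 ≤ r') : IsRateBound n δ (r + r') (N * N') := by
  have hle := h.le hδ hr
  rcases h' with h1 | h1
  · rcases h with h2 | h2
    · left
      rw [h1, h2, mul_one]
    · right
      rw [h1, mul_one]
      refine h2.trans (Real.exp_le_exp.2 ?_)
      gcongr
      linarith
  · right
    rw [PNat.mul_coe, Nat.cast_mul]
    refine (mul_le_mul hle h1 (by positivity) (Real.exp_pos _).le).trans (le_of_eq ?_)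
    rw [← Real.exp_add]
    congr 1
    ring

theorem le_log_blockSize (r δ : ℝ) (n : ℕ) :
    n * (r - δ) - Real.log 2 ≤ Real.log ((blockSize r δ n : ℕ) : ℝ) := by
  -- The size is at least 1 and at least the floor, so rounding loses at most a factor two.
  have h1 : Real.exp (n * (r - δ)) / 2 ≤ ((blockSize r δ n : ℕ) : ℝ) := by
    have h2 := Nat.lt_floor_add_one (Real.exp (n * (r - δ)))
    have h3 : (1 : ℝ) ≤ ((blockSize r δ n : ℕ) : ℝ) := by exact_mod_cast (blockSize r δ n).2
    have h4 : (⌊Real.exp (n * (r - δ))⌋₊ : ℝ) ≤ ((blockSize r δ n : ℕ) : ℝ) := by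
      exact_mod_cast le_max_right 1 ⌊Real.exp (n * (r - δ))⌋₊
    linarith
  have := Real.log_le_log (by positivity) h1
  rwa [Real.log_div (Real.exp_pos _).ne' two_ne_zero, Real.log_exp] at this

theorem log_blockSize_le (hδ : 0 ≤ δ) (hr : 0 ≤ r) :
    Real.log ((blockSize r δ n : ℕ) : ℝ) ≤ n * r := by
  rw [← Real.log_exp (n * r)]
  exact Real.log_le_log (by exact_mod_cast (blockSize r δ n).2) (isRateBound_blockSize.le hδ hr)

theorem tendsto_log_blockSize {δ : ℕ → ℝ} (hδ0 : ∀ n, 0 ≤ δ n) (hδ : Tendsto δ atTop (𝓝 0))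
    (hr : 0 ≤ r) :
    Tendsto (fun n : ℕ => Real.log ((blockSize r (δ n) n : ℕ) : ℝ) / n) atTop (𝓝 r) := by
  have h1 : Tendsto (fun n : ℕ => r - δ n - Real.log 2 / n) atTop (𝓝 r) := by
    simpa using (tendsto_const_nhds.sub hδ).sub
      (tendsto_const_nhds.div_atTop (tendsto_natCast_atTop_atTop (R := ℝ)))
  refine tendsto_of_tendsto_of_tendsto_of_le_of_le' h1 tendsto_const_nhds ?_ ?_
  · filter_upwards [eventually_gt_atTop 0] with n hn
    have hn' : (0 : ℝ) < n := by exact_mod_cast hn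
    rw [le_div_iff₀ hn']
    have := le_log_blockSize r (δ n) n
    have e : (r - δ n - Real.log 2 / n) * n = n * (r - δ n) - Real.log 2 := by field_simp
    linarith
  · filter_upwards [eventually_gt_atTop 0] with n hn
    have hn' : (0 : ℝ) < n := by exact_mod_cast hn
    rw [div_le_iff₀ hn', mul_comm]
    exact log_blockSize_le (hδ0 n) hr

/-- The rate back-off `n ^ (-1/4)`. -/
noncomputable def slack (n : ℕ) : ℝ := (√√n)⁻¹

theorem slack_nonneg (n : ℕ) : 0 ≤ slack n := by unfold slack; positivity

theorem tendsto_slack : Tendsto slack atTop (𝓝 0) :=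
  tendsto_inv_atTop_zero.comp (Real.tendsto_sqrt_atTop.comp
    (Real.tendsto_sqrt_atTop.comp (tendsto_natCast_atTop_atTop (R := ℝ))))

end Rates

/-! ### Choice of rates and convergence -/

section Achievability

variable {𝒳 𝒴 𝒵₁ 𝒵₂ 𝒰 𝒱 : Type*} [Fintype 𝒳] [Fintype 𝒴] [Fintype 𝒵₁] [Fintype 𝒵₂]
  [Fintype 𝒰] [Fintype 𝒱]

/-- `hK` and `hJ` fill both layers up to what Y can decode; `hU` and `hV` let the dummy indices hide
everything from Z₂, and `hS` lets b₂ and the satellite dummy hide M₁ from Z₁. The leakages carry the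
factor 1/n, so a single inequality yields all three limits. -/
theorem exists_codes_of_rates (W : Channel 𝒳 𝒴 𝒵₁ 𝒵₂) (κ : 𝒱 → PMF 𝒳) {p : 𝒰 → ℝ}
    {q : 𝒰 → 𝒱 → ℝ} (hp : p ∈ stdSimplex ℝ 𝒰) (hq : ∀ u, q u ∈ stdSimplex ℝ 𝒱)
    {r₁ a₂ b₂ ra rb : ℝ} (hr₁ : 0 ≤ r₁) (ha₂ : 0 ≤ a₂) (hb₂ : 0 ≤ b₂) (hra : 0 ≤ ra) (hrb : 0 ≤ rb)
    (hK : r₁ + (b₂ + rb) = condInfo p q (outKernel κ W fun o => o.1))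
    (hJ : a₂ + ra = infoU p q (outKernel κ W fun o => o.1))
    (hU : infoU p q (outKernel κ W fun o => o.2.2) ≤ ra)
    (hV : infoV p q (outKernel κ W fun o => o.2.2) ≤ ra + rb)
    (hS : condInfo p q (outKernel κ W fun o => o.2.1) ≤ b₂ + rb) :
    ∃ c : ℝ, ∀ n : ℕ, 1 ≤ n → ∃ code : Code 𝒳 𝒴 (blockSize r₁ (slack n) n)
        (blockSize a₂ (slack n) n * blockSize b₂ (slack n) n) n,
      code.errorProb W + (n : ℝ)⁻¹ * (code.leakWeak W * Real.log 2) +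
        (n : ℝ)⁻¹ * (code.leakStrong W * Real.log 2) ≤ c * slack n := by
  have hY := outKernel_mem_stdSimplex κ W fun o => o.1
  obtain ⟨ce, hce, he⟩ := exists_error_bound hp hq hY
  obtain ⟨cw, hcw, hw⟩ := exists_weak_bound hp hq (outKernel_mem_stdSimplex κ W fun o => o.2.2)
  obtain ⟨cs, hcs, hs⟩ := exists_strong_bound hp hq (outKernel_mem_stdSimplex κ W fun o => o.2.1)
  refine ⟨(4 + 2 * ce) + (Real.log 3 + cw + (2 + 2 * Real.log 2) + (1 + Real.log 2)) +
    (Real.log 3 + cs + (2 + 2 * Real.log 2)), fun n hn => ?_⟩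
  have hn' : (1 : ℝ) ≤ n := by exact_mod_cast hn
  set δ := slack n with hδdef
  -- With n = s⁴ and δ = 1/s one has nδ = s³ and √n/(nδ) = δ, while √n/n = s⁻² and 1/n = s⁻⁴ are at
  -- most δ. Hence every term is O(δ).
  set s := √√(n : ℝ) with hs_def
  have hs1 : 1 ≤ s := by
    rw [hs_def, Real.one_le_sqrt, Real.one_le_sqrt]; exact hn'
  have hs0 : 0 < s := by linarith
  have hsδ : δ = s⁻¹ := rfl
  have hsq : √(n : ℝ) = s ^ 2 := (Real.sq_sqrt (Real.sqrt_nonneg _)).symm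
  have hn4 : (n : ℝ) = s ^ 4 := by
    rw [show s ^ 4 = (s ^ 2) ^ 2 by ring, ← hsq, Real.sq_sqrt (by positivity)]
  have hδ : 0 < δ := by rw [hsδ]; positivity
  have hδ1 : δ ≤ 1 := by rw [hsδ]; exact inv_le_one_of_one_le₀ hs1
  set M₁ := blockSize r₁ δ n
  set A₂ := blockSize a₂ δ n
  set B₂ := blockSize b₂ δ n
  set Ra := blockSize ra δ n
  set Rb := blockSize rb δ n
  have bK : IsRateBound n δ (r₁ + (b₂ + rb)) (M₁ * (B₂ * Rb)) :=
    isRateBound_blockSize.mul (isRateBound_blockSize.mul isRateBound_blockSize hδ.le hb₂ hrb) hδ.le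
      hr₁ (by positivity)
  have bJ : IsRateBound n δ (a₂ + ra) (A₂ * Ra) :=
    isRateBound_blockSize.mul isRateBound_blockSize hδ.le ha₂ hra
  have hKle := bK.le hδ.le (by positivity)
  have hJK : (((A₂ * Ra : ℕ+) : ℕ) - 1 : ℝ) * ((M₁ * (B₂ * Rb) : ℕ+) : ℕ) ≤
      Real.exp (n * (infoV p q (outKernel κ W fun o => o.1) - δ)) := by
    refine (mul_le_mul bJ.sub_one_le hKle (by positivity) (Real.exp_pos _).le).trans (le_of_eq ?_)
    rw [← Real.exp_add, infoV_eq hp hq hY, ← hK, ← hJ]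
    congr 1
    ring
  have lA := le_log_blockSize ra δ n
  have lB := le_log_blockSize rb δ n
  have lC := le_log_blockSize b₂ δ n
  have pos : ∀ N : ℕ+, ((N : ℕ) : ℝ) ≠ 0 := fun N => by exact_mod_cast N.ne_zero
  have e1 := he n (A₂ * Ra : ℕ+) (M₁ * (B₂ * Rb) : ℕ+) δ hn (PNat.pos _) (PNat.pos _) hδ
    (hK ▸ bK.sub_one_le) hJK
  have e2 := hw n Ra Rb (PNat.pos _) (PNat.pos _)
  have e3 := hs n (B₂ * Rb : ℕ+) (PNat.pos _)
  obtain ⟨code, hcode⟩ := exists_code_le_mean W κ hp hq M₁ A₂ B₂ Ra Rb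
    (t := (n : ℝ)⁻¹) (by positivity) e1 e2 e3
  refine ⟨code, hcode.trans ?_⟩
  have hl2 : 0 ≤ Real.log 2 := Real.log_nonneg one_le_two
  have hl3 : 0 ≤ Real.log 3 := Real.log_nonneg (by norm_num)
  have hninv : (n : ℝ)⁻¹ ≤ δ := by
    rw [hsδ, hn4]
    exact inv_anti₀ hs0 (le_self_pow₀ hs1 (by norm_num))
  have hninv0 : 0 ≤ (n : ℝ)⁻¹ := by positivity
  have hsqn : (n : ℝ)⁻¹ * √n ≤ δ := by
    rw [hsδ, hn4, show √(s ^ 4) = s ^ 2 by rw [← hn4, hsq], inv_mul_le_iff₀ (by positivity)]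
    have : s ^ 4 * s⁻¹ = s ^ 3 := by field_simp
    rw [this]
    exact pow_le_pow_right₀ hs1 (by norm_num)
  have hnn : (n : ℝ)⁻¹ * n = 1 := inv_mul_cancel₀ (by positivity)
  have f1 : 2 * Real.exp (-(n * δ / 2)) + ce * √n / (n * δ / 2) ≤ (4 + 2 * ce) * δ := by
    have hnδ : n * δ = s ^ 3 := by rw [hn4, hsδ]; field_simp
    rw [hnδ, hsq]
    have g1 : Real.exp (-(s ^ 3 / 2)) ≤ 2 * δ := by
      rw [Real.exp_neg, hsδ]
      have g3 := Real.add_one_le_exp (s ^ 3 / 2)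
      have g4 : s ≤ s ^ 3 := le_self_pow₀ hs1 (by norm_num)
      rw [inv_le_comm₀ (Real.exp_pos _) (by positivity)]
      have : (2 * s⁻¹)⁻¹ = s / 2 := by field_simp
      rw [this]
      linarith
    have g2 : ce * s ^ 2 / (s ^ 3 / 2) = 2 * ce * δ := by
      rw [hsδ]; field_simp
    rw [g2]
    linarith
  have f2 : (n : ℝ)⁻¹ * (Real.log 3 + cw * √n +
      max 0 (n * infoV p q (outKernel κ W fun o => o.2.2) - Real.log ((Ra : ℕ) * (Rb : ℕ))) +
      max 0 (n * infoU p q (outKernel κ W fun o => o.2.2) - Real.log (Ra : ℕ))) ≤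
      (Real.log 3 + cw + (2 + 2 * Real.log 2) + (1 + Real.log 2)) * δ := by
    -- Each of the two dummy sizes falls short of its nominal rate by at most nδ + log 2 in the
    -- logarithm.
    have g1 : max 0 (n * infoV p q (outKernel κ W fun o => o.2.2) -
        Real.log ((Ra : ℕ) * (Rb : ℕ))) ≤ n * (2 * δ) + 2 * Real.log 2 := by
      rw [Real.log_mul (pos _) (pos _)]
      refine max_le (by positivity) ?_
      have := mul_le_mul_of_nonneg_left hV (zero_le_one.trans hn')
      linarith
    have g2 : max 0 (n * infoU p q (outKernel κ W fun o => o.2.2) - Real.log (Ra : ℕ)) ≤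
        n * δ + Real.log 2 := by
      refine max_le (by positivity) ?_
      have := mul_le_mul_of_nonneg_left hU (zero_le_one.trans hn')
      linarith
    calc _ ≤ (n : ℝ)⁻¹ * (Real.log 3 + cw * √n + (n * (2 * δ) + 2 * Real.log 2) +
          (n * δ + Real.log 2)) := by gcongr
      _ = (n : ℝ)⁻¹ * Real.log 3 + cw * ((n : ℝ)⁻¹ * √n) + ((n : ℝ)⁻¹ * n) * (3 * δ) +
          3 * ((n : ℝ)⁻¹ * Real.log 2) := by ring
      _ ≤ δ * Real.log 3 + cw * δ + 1 * (3 * δ) + 3 * (δ * Real.log 2) := by rw [hnn]; gcongr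
      _ = _ := by ring
  have f3 : (n : ℝ)⁻¹ * (Real.log 3 + cs * √n +
      max 0 (n * condInfo p q (outKernel κ W fun o => o.2.1) -
        Real.log ((B₂ * Rb : ℕ+) : ℕ))) ≤
      (Real.log 3 + cs + (2 + 2 * Real.log 2)) * δ := by
    have g1 : max 0 (n * condInfo p q (outKernel κ W fun o => o.2.1) -
        Real.log ((B₂ * Rb : ℕ+) : ℕ)) ≤ n * (2 * δ) + 2 * Real.log 2 := by
      rw [PNat.mul_coe, Nat.cast_mul, Real.log_mul (pos _) (pos _)]
      refine max_le (by positivity) ?_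
      have := mul_le_mul_of_nonneg_left hS (zero_le_one.trans hn')
      linarith
    calc _ ≤ (n : ℝ)⁻¹ * (Real.log 3 + cs * √n + (n * (2 * δ) + 2 * Real.log 2)) := by gcongr
      _ = (n : ℝ)⁻¹ * Real.log 3 + cs * ((n : ℝ)⁻¹ * √n) + ((n : ℝ)⁻¹ * n) * (2 * δ) +
          2 * ((n : ℝ)⁻¹ * Real.log 2) := by ring
      _ ≤ δ * Real.log 3 + cs * δ + 1 * (2 * δ) + 2 * (δ * Real.log 2) := by rw [hnn]; gcongr
      _ = _ := by ring
  linarith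

/-- Achievability in terms of a chain `U → V → (Y, Z₁, Z₂)` given by kernels, rates in nats. -/
theorem isAchievable_of_kernels (W : Channel 𝒳 𝒴 𝒵₁ 𝒵₂) (κ : 𝒱 → PMF 𝒳) {p : 𝒰 → ℝ}
    {q : 𝒰 → 𝒱 → ℝ} (hp : p ∈ stdSimplex ℝ 𝒰) (hq : ∀ u, q u ∈ stdSimplex ℝ 𝒱)
    {r₁ r₂ : ℝ} (hr₁ : 0 ≤ r₁) (hr₂ : 0 ≤ r₂)
    (hU : infoU p q (outKernel κ W fun o => o.2.2) ≤ infoU p q (outKernel κ W fun o => o.1))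
    (h₁ : r₁ ≤ condInfo p q (outKernel κ W fun o => o.1) -
      condInfo p q (outKernel κ W fun o => o.2.1))
    (h₂ : r₁ + r₂ ≤ infoV p q (outKernel κ W fun o => o.1) -
      infoV p q (outKernel κ W fun o => o.2.2)) :
    W.IsAchievable (r₁ / Real.log 2) (r₂ / Real.log 2) := by
  have hY := outKernel_mem_stdSimplex κ W fun o => o.1
  have hZ₁ := outKernel_mem_stdSimplex κ W fun o => o.2.1
  have hZ₂ := outKernel_mem_stdSimplex κ W fun o => o.2.2
  have c1 := condInfo_nonneg hp hq hZ₁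
  have c2 := condInfo_nonneg hp hq hZ₂
  have u2 := infoU_nonneg hp hq hZ₂
  have v0 := infoV_eq hp hq hY
  have v2 := infoV_eq hp hq hZ₂
  set S := condInfo p q (outKernel κ W fun o => o.1) - r₁ with hSdef
  have hS0 : 0 ≤ S := by linarith
  -- S is the satellite rate left beside M₁. As much of M₂ as possible goes there, the rest into the
  -- clouds, and dummy indices fill both layers. Then ra + rb = I(V;Y) - r₁ - r₂ ≥ I(V;Z₂).
  set b₂ := min S r₂ with hb₂def
  have hb₂S : b₂ ≤ S := min_le_left _ _
  have hb₂r : b₂ ≤ r₂ := min_le_right _ _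
  have hb₂ : 0 ≤ b₂ := le_min hS0 hr₂
  have hra : infoU p q (outKernel κ W fun o => o.2.2) ≤
      infoU p q (outKernel κ W fun o => o.1) - (r₂ - b₂) := by
    -- If all of M₂ fits among the satellites, ra = I(U;Y) and the hypothesis on U applies.
    -- Otherwise rb = 0, so ra = I(V;Y) - r₁ - r₂ ≥ I(V;Z₂) ≥ I(U;Z₂).
    rcases min_choice S r₂ with h | h <;> rw [← hb₂def] at h <;> rw [h] <;> linarith
  obtain ⟨c, hc⟩ := exists_codes_of_rates W κ hp hq (r₁ := r₁) (a₂ := r₂ - b₂) (b₂ := b₂)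
    (ra := infoU p q (outKernel κ W fun o => o.1) - (r₂ - b₂)) (rb := S - b₂)
    hr₁ (by linarith) hb₂ (by linarith) (by linarith) (by linarith) (by linarith) hra
    (by linarith) (by linarith)
  have hc' : ∀ n : ℕ, ∃ code : Code 𝒳 𝒴 (blockSize r₁ (slack n) n)
        (blockSize (r₂ - b₂) (slack n) n * blockSize b₂ (slack n) n) n, 1 ≤ n →
      code.errorProb W + (n : ℝ)⁻¹ * (code.leakWeak W * Real.log 2) +
        (n : ℝ)⁻¹ * (code.leakStrong W * Real.log 2) ≤ c * slack n := fun n => by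
    -- A code is demanded for block length 0 too; any will do, but writing one down needs a letter
    -- of 𝒱, which exists because p has total mass one.
    rcases Nat.eq_zero_or_pos n with rfl | hn
    · have : Nonempty 𝒱 := by
        by_contra hV
        rw [not_nonempty_iff] at hV
        have hu : ∀ u : 𝒰, False := fun u => by simpa using (hq u).2
        have : IsEmpty 𝒰 := ⟨hu⟩
        simpa using hp.2
      exact ⟨⟨fun _ => piPMF fun _ => κ (Classical.arbitrary 𝒱), fun _ => Classical.arbitrary _⟩,
        by simp⟩
    · obtain ⟨code, h⟩ := hc n hn
      exact ⟨code, fun _ => h⟩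
  choose code hcode using hc'
  have hl : 0 < Real.log 2 := Real.log_pos one_lt_two
  have hlim : Tendsto (fun n => c * slack n) atTop (𝓝 0) := by
    simpa using tendsto_slack.const_mul c
  have hlim' : Tendsto (fun n => c * slack n / Real.log 2) atTop (𝓝 0) := by
    simpa using hlim.div_const (Real.log 2)
  -- Nonnegativity of the three terms lets the bound on their sum control each one.
  have hpos : ∀ n : ℕ, 0 ≤ (code n).errorProb W ∧ 0 ≤ (n : ℝ)⁻¹ * ((code n).leakWeak W) ∧
      0 ≤ (n : ℝ)⁻¹ * ((code n).leakStrong W) := fun n =>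
    ⟨ENNReal.toReal_nonneg, mul_nonneg (by positivity) (mutualInfo_nonneg _ _ _),
      mul_nonneg (by positivity) (mutualInfo_nonneg _ _ _)⟩
  have pos : ∀ N : ℕ+, ((N : ℕ) : ℝ) ≠ 0 := fun N => by exact_mod_cast N.ne_zero
  refine ⟨_, _, code, ?_, ?_, ?_, ?_, ?_⟩
  · refine ((tendsto_log_blockSize slack_nonneg tendsto_slack hr₁).div_const (Real.log 2)).congr
      fun n => ?_
    rw [Real.logb, div_right_comm]
  · have := ((tendsto_log_blockSize slack_nonneg tendsto_slack (sub_nonneg.2 hb₂r)).add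
      (tendsto_log_blockSize slack_nonneg tendsto_slack hb₂)).div_const (Real.log 2)
    rw [sub_add_cancel] at this
    refine this.congr fun n => ?_
    rw [Real.logb, PNat.mul_coe, Nat.cast_mul, Real.log_mul (pos _) (pos _), div_right_comm,
      ← add_div]
  · refine tendsto_of_tendsto_of_tendsto_of_le_of_le' tendsto_const_nhds hlim
      (Eventually.of_forall fun n => (hpos n).1) ?_
    filter_upwards [eventually_ge_atTop 1] with n hn
    have h := hcode n hn
    have h1 := mul_nonneg (hpos n).2.1 hl.le
    have h2 := mul_nonneg (hpos n).2.2 hl.le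
    rw [mul_assoc] at h1 h2
    linarith
  · refine tendsto_of_tendsto_of_tendsto_of_le_of_le' tendsto_const_nhds hlim'
      (Eventually.of_forall fun n => by rw [div_eq_inv_mul]; exact (hpos n).2.1) ?_
    filter_upwards [eventually_ge_atTop 1] with n hn
    have h := hcode n hn
    have h0 := (hpos n).1
    have h2 := mul_nonneg (hpos n).2.2 hl.le
    rw [mul_assoc] at h2
    rw [div_eq_inv_mul, le_div_iff₀ hl, mul_assoc]
    linarith
  · refine tendsto_of_tendsto_of_tendsto_of_le_of_le' tendsto_const_nhds hlim'
      (Eventually.of_forall fun n => by rw [div_eq_inv_mul]; exact (hpos n).2.2) ?_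
    filter_upwards [eventually_ge_atTop 1] with n hn
    have h := hcode n hn
    have h0 := (hpos n).1
    have h1 := mul_nonneg (hpos n).2.1 hl.le
    rw [mul_assoc] at h1
    rw [div_eq_inv_mul, le_div_iff₀ hl, mul_assoc]
    linarith

end Achievability

/-! ### From joint laws to kernels -/

section Final

theorem exists_kernel {α β : Type*} [Fintype α] [Fintype β] (p : PMF (α × β)) :
    ∃ κ : α → PMF β, ∀ a b, (p (a, b)).toReal = ((p.map Prod.fst) a).toReal * (κ a b).toReal := by
  classical
  obtain ⟨x, hx⟩ := p.support_nonempty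
  have hκ : ∀ a, ∃ κ : PMF β, ∀ b, (p (a, b)).toReal =
      ((p.map Prod.fst) a).toReal * (κ b).toReal := fun a => by
    rcases eq_or_ne ((p.map Prod.fst) a).toReal 0 with h0 | h0
    -- On a null event the conditional law is arbitrary; a support point only supplies some element
    -- of β.
    · refine ⟨PMF.pure x.2, fun b => ?_⟩
      have := le_toReal_map_apply p Prod.fst (a, b)
      rw [h0] at this ⊢
      rw [zero_mul]
      exact le_antisymm this ENNReal.toReal_nonneg
    · have hsum : ∑ b, ENNReal.ofReal ((p (a, b)).toReal / ((p.map Prod.fst) a).toReal) = 1 := by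
        rw [← ENNReal.ofReal_sum_of_nonneg fun b _ => by positivity, ← Finset.sum_div,
          ← map_fst_apply_toReal, div_self h0, ENNReal.ofReal_one]
      refine ⟨PMF.ofFintype _ hsum, fun b => ?_⟩
      rw [PMF.ofFintype_apply, ENNReal.toReal_ofReal (by positivity), mul_div_cancel₀ _ h0]
  choose κ hκ using hκ
  exact ⟨κ, hκ⟩

variable {𝒳 𝒴 𝒵₁ 𝒵₂ 𝒰 𝒱 : Type*} [Fintype 𝒳] [Fintype 𝒴] [Fintype 𝒵₁] [Fintype 𝒵₂]
  [Fintype 𝒰] [Fintype 𝒱]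

/-- A Markov chain `U → V → X` factors into kernels. -/
theorem IsMarkovChain.exists_kernels {p : PMF (𝒰 × 𝒱 × 𝒳)}
    (hM : IsMarkovChain p (fun a => a.1) (fun a => a.2.1) (fun a => a.2.2)) :
    ∃ (pU : PMF 𝒰) (q : 𝒰 → PMF 𝒱) (κ : 𝒱 → PMF 𝒳), ∀ u v x,
      (p (u, v, x)).toReal = (pU u).toReal * (q u v).toReal * (κ v x).toReal := by
  obtain ⟨q, hq⟩ := exists_kernel (p.map fun a => (a.1, a.2.1))
  obtain ⟨κ, hκ⟩ := exists_kernel (p.map fun a => (a.2.1, a.2.2))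
  refine ⟨p.map fun a => a.1, q, κ, fun u v x => ?_⟩
  have h := congrArg ENNReal.toReal (hM u v x)
  have e : (p.map fun ω => (ω.1, ω.2.1, ω.2.2)) = p := p.map_id
  simp only [ENNReal.toReal_mul, hq, hκ, PMF.map_comp, Function.comp_def, e] at h
  -- The Markov identity can be divided by p(v) unless p(v) = 0, and then both sides of the
  -- factorization vanish.
  rcases eq_or_ne ((p.map fun a => a.2.1) v).toReal 0 with h0 | h0
  · have h1 := le_toReal_map_apply p (fun a => a.2.1) (u, v, x)
    have h2 := le_toReal_map_apply (p.map fun a => (a.1, a.2.1)) Prod.snd (u, v)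
    rw [hq] at h2
    simp only [PMF.map_comp, Function.comp_def, h0] at h1 h2
    have h3 : ((p.map fun a => a.1) u).toReal * (q u v).toReal = 0 :=
      le_antisymm h2 (by positivity)
    rw [h3, zero_mul]
    exact le_antisymm h1 ENNReal.toReal_nonneg
  · apply mul_right_cancel₀ h0
    rw [h]
    ring

/-- Joint law of `U`, `V` and the component `g` of the channel output. -/
theorem jointLaw_map_chain {𝒵 : Type*} [Fintype 𝒵] {p : PMF (𝒰 × 𝒱 × 𝒳)} {pU : PMF 𝒰}
    {q : 𝒰 → PMF 𝒱} {κ : 𝒱 → PMF 𝒳}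
    (hp : ∀ u v x, (p (u, v, x)).toReal = (pU u).toReal * (q u v).toReal * (κ v x).toReal)
    (W : Channel 𝒳 𝒴 𝒵₁ 𝒵₂) (g : 𝒴 × 𝒵₁ × 𝒵₂ → 𝒵) (u : 𝒰) (v : 𝒱) (z : 𝒵) :
    (((jointLaw p (fun a => a.2.2) W).map fun ω => (ω.1.1, ω.1.2.1, g ω.2)) (u, v, z)).toReal =
      (pU u).toReal * (q u v).toReal * outKernel κ W g v z := by
  classical
  have h1 : ((jointLaw p (fun a => a.2.2) W).map fun ω => (ω.1.1, ω.1.2.1, g ω.2)) =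
      (jointLaw p (fun a => a.2.2) fun x => (W x).map g).map fun ω => (ω.1.1, ω.1.2.1, ω.2) := by
    rw [← jointLaw_map, PMF.map_comp]; rfl
  have h2 : outKernel κ W g v z = ∑ x, (κ v x).toReal * (((W x).map g) z).toReal := by
    rw [outKernel, PMF.map_bind, PMF.bind_apply, tsum_fintype, ENNReal.toReal_sum]
    · simp_rw [ENNReal.toReal_mul]
    · intro x _
      exact ENNReal.mul_ne_top (PMF.apply_ne_top _ _) (PMF.apply_ne_top _ _)
  rw [h1, toReal_map_apply, h2]
  simp only [Fintype.sum_prod_type, jointLaw_apply, ENNReal.toReal_mul, hp]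
  rw [Finset.sum_eq_single u, Finset.sum_eq_single v]
  · simp [Finset.mul_sum, mul_assoc]
  · intro v' _ hv'; simp [hv']
  · simp
  · intro u' _ hu'; simp [hu']
  · simp

/-- Achievability with auxiliary variables `U → V → X`. -/
theorem isAchievable_of_markovChain (W : Channel 𝒳 𝒴 𝒵₁ 𝒵₂) {R₁ R₂ : ℝ} (hR₁ : 0 ≤ R₁)
    (hR₂ : 0 ≤ R₂) (p : PMF (𝒰 × 𝒱 × 𝒳))
    (hM : IsMarkovChain p (fun a => a.1) (fun a => a.2.1) (fun a => a.2.2))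
    (hU : mutualInfo (jointLaw p (fun a => a.2.2) W) (fun ω => ω.1.1) (fun ω => ω.2.2.2) ≤
      mutualInfo (jointLaw p (fun a => a.2.2) W) (fun ω => ω.1.1) (fun ω => ω.2.1))
    (h₁ : R₁ ≤ condMutualInfo (jointLaw p (fun a => a.2.2) W) (fun ω => ω.1.2.1) (fun ω => ω.2.1)
        (fun ω => ω.1.1) -
      condMutualInfo (jointLaw p (fun a => a.2.2) W) (fun ω => ω.1.2.1) (fun ω => ω.2.2.1)
        (fun ω => ω.1.1))
    (h₂ : R₁ + R₂ ≤
      mutualInfo (jointLaw p (fun a => a.2.2) W) (fun ω => ω.1.2.1) (fun ω => ω.2.1) -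
      mutualInfo (jointLaw p (fun a => a.2.2) W) (fun ω => ω.1.2.1) (fun ω => ω.2.2.2)) :
    W.IsAchievable R₁ R₂ := by
  obtain ⟨pU, q, κ, hp⟩ := hM.exists_kernels
  have hl : 0 < Real.log 2 := Real.log_pos one_lt_two
  set P := jointLaw p (fun a => a.2.2) W with hP
  have sU := toReal_mem_stdSimplex pU
  have sq := fun u => toReal_mem_stdSimplex (q u)
  have eY := jointLaw_map_chain hp W fun o => o.1
  have eZ₁ := jointLaw_map_chain hp W fun o => o.2.1
  have eZ₂ := jointLaw_map_chain hp W fun o => o.2.2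
  have sY := outKernel_mem_stdSimplex κ W fun o => o.1
  have sZ₁ := outKernel_mem_stdSimplex κ W fun o => o.2.1
  have sZ₂ := outKernel_mem_stdSimplex κ W fun o => o.2.2
  have a1 := mutualInfo_chain_left sU sq sZ₂ eZ₂
  have a2 := mutualInfo_chain_left sU sq sY eY
  have a3 := mutualInfo_chain_right sU sq sZ₂ eZ₂
  have a4 := mutualInfo_chain_right sU sq sY eY
  have a5 := condMutualInfo_chain sU sq sZ₁ eZ₁
  have a6 := condMutualInfo_chain sU sq sY eY
  rw [mutualInfo_map] at a1 a2 a3 a4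
  rw [condMutualInfo_map] at a5 a6
  simp only [Function.comp_def] at a1 a2 a3 a4 a5 a6
  rw [a1, a2, div_le_div_iff_of_pos_right hl] at hU
  rw [a5, a6, ← sub_div, le_div_iff₀ hl] at h₁
  rw [a3, a4, ← sub_div, le_div_iff₀ hl, add_mul] at h₂
  have := isAchievable_of_kernels W κ sU sq (mul_nonneg hR₁ hl.le) (mul_nonneg hR₂ hl.le) hU h₁ h₂
  rwa [mul_div_cancel_right₀ _ hl.ne', mul_div_cancel_right₀ _ hl.ne'] at this

end Final

/-! ### Trivial auxiliary variables -/

section Constant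

variable {Ω α β : Type*}

theorem map_apply_of_injective (p : PMF α) {f : α → β} (hf : Function.Injective f) (a : α) :
    (p.map f) (f a) = p a := by
  classical
  rw [PMF.map_apply, tsum_eq_single a, if_pos rfl]
  exact fun b hb => if_neg fun h => hb (hf h).symm

theorem entropy_map_of_injective [Fintype α] [Fintype β] (p : PMF α) {f : α → β}
    (hf : Function.Injective f) : entropy (p.map f) = entropy p := by
  rw [entropy_map]
  simp [map_apply_of_injective p hf, entropy, Real.negMulLog]

theorem entropy_map_const (P : PMF Ω) : entropy (P.map fun _ => ()) = 0 := by
  have : (P.map fun _ => ()) = PMF.pure () := PMF.map_const P ()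
  rw [this]
  simp [entropy]

theorem isMarkovChain_unit_diag (p : PMF α) :
    IsMarkovChain (p.map fun x => ((), x, x)) (fun a => a.1) (fun a => a.2.1)
      (fun a => a.2.2) := by
  classical
  rintro ⟨⟩ b c
  simp only [PMF.map_comp, Function.comp_def]
  rcases eq_or_ne b c with rfl | h
  · rw [map_apply_of_injective p (f := fun x => ((), x, x)) (fun _ _ h => by simpa using h),
      map_apply_of_injective p (f := fun x => x) (fun _ _ h => h),
      map_apply_of_injective p (f := fun x => ((), x)) (fun _ _ h => by simpa using h),
      map_apply_of_injective p (f := fun x => (x, x)) (fun _ _ h => by simpa using h)]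
  · have h1 : (p.map fun x => ((), x, x)) ((), b, c) = 0 := by
      rw [PMF.map_apply, ENNReal.tsum_eq_zero]
      exact fun x => if_neg fun hx => h (by simp_all)
    have h2 : (p.map fun x => (x, x)) (b, c) = 0 := by
      rw [PMF.map_apply, ENNReal.tsum_eq_zero]
      exact fun x => if_neg fun hx => h (by simp_all)
    rw [h1, h2, zero_mul, mul_zero]

variable [Fintype α] [Fintype β]

theorem mutualInfo_unit_left (P : PMF Ω) (B : Ω → β) : mutualInfo P (fun _ => ()) B = 0 := by
  have h := entropy_map_of_injective (P.map B) (f := fun b => ((), b)) fun _ _ h => by simpa using h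
  rw [PMF.map_comp, Function.comp_def] at h
  rw [mutualInfo, entropy_map_const, h]
  ring

theorem condMutualInfo_unit (P : PMF Ω) (A : Ω → α) (B : Ω → β) :
    condMutualInfo P A B (fun _ => ()) = mutualInfo P A B := by
  have h1 := entropy_map_of_injective (P.map A) (f := fun a => (a, ())) fun _ _ h => by
    simpa using h
  have h2 := entropy_map_of_injective (P.map B) (f := fun b => (b, ())) fun _ _ h => by
    simpa using h
  have h3 := entropy_map_of_injective (P.map fun ω => (A ω, B ω)) (f := fun t => (t.1, t.2, ()))
    fun _ _ h => by simpa [Prod.ext_iff] using h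
  rw [PMF.map_comp, Function.comp_def] at h1 h2 h3
  rw [condMutualInfo, entropy_map_const, h1, h2, h3, mutualInfo]
  ring

theorem jointLaw_unit_diag {𝒳 𝒪 : Type*} (p : PMF 𝒳) (W : 𝒳 → PMF 𝒪) :
    jointLaw (p.map fun x => ((), x, x)) (fun a => a.2.2) W =
      (jointLaw p id W).map fun ω => (((), ω.1, ω.1), ω.2) := by
  simp [jointLaw, PMF.bind_map, PMF.map_bind, PMF.map_comp, Function.comp_def]

end Constant

end TwoLevelWiretap

theorem theorem1 {𝒳 𝒴 𝒵₁ 𝒵₂ : Type*} [Fintype 𝒳] [Fintype 𝒴] [Fintype 𝒵₁] [Fintype 𝒵₂]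
    (W : Channel 𝒳 𝒴 𝒵₁ 𝒵₂) (hW : W.IsDegraded) (R₁ R₂ : ℝ) (hR₁ : 0 ≤ R₁) (hR₂ : 0 ≤ R₂) :
    ((∃ p : PMF 𝒳,
        let P := jointLaw p id W
        let X := fun ω : 𝒳 × 𝒴 × 𝒵₁ × 𝒵₂ => ω.1
        let Y := fun ω : 𝒳 × 𝒴 × 𝒵₁ × 𝒵₂ => ω.2.1
        let Z₁ := fun ω : 𝒳 × 𝒴 × 𝒵₁ × 𝒵₂ => ω.2.2.1
        let Z₂ := fun ω : 𝒳 × 𝒴 × 𝒵₁ × 𝒵₂ => ω.2.2.2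
        R₁ ≤ mutualInfo P X Y - mutualInfo P X Z₁ ∧
        R₁ + R₂ ≤ mutualInfo P X Y - mutualInfo P X Z₂) →
      W.IsAchievable R₁ R₂) ∧
    (∀ (𝒰 𝒱 : Type*) [Fintype 𝒰] [Fintype 𝒱],
      (∃ p : PMF (𝒰 × 𝒱 × 𝒳),
        let P := jointLaw p (fun a => a.2.2) W
        let U := fun ω : (𝒰 × 𝒱 × 𝒳) × 𝒴 × 𝒵₁ × 𝒵₂ => ω.1.1
        let V := fun ω : (𝒰 × 𝒱 × 𝒳) × 𝒴 × 𝒵₁ × 𝒵₂ => ω.1.2.1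
        let Y := fun ω : (𝒰 × 𝒱 × 𝒳) × 𝒴 × 𝒵₁ × 𝒵₂ => ω.2.1
        let Z₁ := fun ω : (𝒰 × 𝒱 × 𝒳) × 𝒴 × 𝒵₁ × 𝒵₂ => ω.2.2.1
        let Z₂ := fun ω : (𝒰 × 𝒱 × 𝒳) × 𝒴 × 𝒵₁ × 𝒵₂ => ω.2.2.2
        IsMarkovChain p (fun a => a.1) (fun a => a.2.1) (fun a => a.2.2) ∧
        mutualInfo P U Z₂ ≤ mutualInfo P U Y ∧
        R₁ ≤ condMutualInfo P V Y U - condMutualInfo P V Z₁ U ∧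
        R₁ + R₂ ≤ mutualInfo P V Y - mutualInfo P V Z₂) →
      W.IsAchievable R₁ R₂) := by
  refine ⟨?_, ?_⟩
  -- The choice U constant and V = X: both informations of U vanish, and conditioning on U has no
  -- effect.
  · rintro ⟨p, h₁, h₂⟩
    refine isAchievable_of_markovChain W hR₁ hR₂ _ (isMarkovChain_unit_diag p) ?_ ?_ ?_
    · rw [mutualInfo_unit_left, mutualInfo_unit_left]
    · rw [condMutualInfo_unit, condMutualInfo_unit, jointLaw_unit_diag, mutualInfo_map,
        mutualInfo_map]
      exact h₁
    · rw [jointLaw_unit_diag, mutualInfo_map, mutualInfo_map]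
      exact h₂
  · rintro 𝒰 𝒱 _ _ ⟨p, hM, hU, h₁, h₂⟩
    exact isAchievable_of_markovChain W hR₁ hR₂ p hM hU h₁ h₂
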